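/- Write $\tau = x+iy$ for a point of the upper half plane $\mathbb{H}$, let $\Gamma_\infty = \{\pm\begin{pmatrix}1&n\\0&1\end{pmatrix} : n\in\mathbb{Z}\}$, and for $k \in \mathbb{Z}$, $m \in \mathbb{Z}_{\ge 0}$ let $(f|_k\gamma)(\tau) = (c\tau+d)^{-k} f(\gamma\tau)$ for $f:\mathbb{H}\to\mathbb{C}$, and $(f|_{k,m}\gamma)(\tau)(X) = (cX+d)^m (c\tau+d)^{-k} f(\gamma\tau)(\gamma X)$ for functions $f$ from $\mathbb{H}$ to the space of complex polynomials in $X$ of degree at most $m$, where $\gamma=\begin{pmatrix}a&b\\c&d\end{pmatrix}\in\mathrm{SL}_2(\mathbb{Z})$. For $0\le j\le m$ put $$\mathfrak{e}_{j,m-j}(\tau) = \frac{(-1)^{m-j}}{j!}\, y^{j-m} (X-\tau)^j (X-\overline\tau)^{m-j},$$ and define, wherever the series converge absolutely, $$E_k(\tau,s) = \sum_{\gamma\in\Gamma_\infty\backslash\mathrm{SL}_2(\mathbb{Z})} y^s|_k\gamma,\quad E_{k,m}(\tau,j,s) = \sum_{\gamma\in\Gamma_\infty\backslash\mathrm{SL}_2(\mathbb{Z})}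 (X-\tau)^j y^s|_{k,m}\gamma,\quad E^{\mathrm{ahol}}_{k,m}(\tau,j,s) = \sum_{\gamma\in\Gamma_\infty\backslash\mathrm{SL}_2(\mathbb{Z})} \mathfrak{e}_{j,m-j}\,y^s|_{k,m}\gamma .$$ Proposition. Let $k$, $m\ge 0$ and $0\le j\le m$ be integers with $k\equiv m \pmod 2$, and let $\tau\in\mathbb{H}$. For every $s\in\mathbb{C}$ with $2\,\mathrm{Re}(s)+k>2+m$, all the series that occur below converge absolutely, and $$E_{k,m}(\tau,j,s) = \Big(\frac i2\Big)^{m-j}\sum_{r=j}^m \binom{m-j}{r-j}\, r!\;\mathfrak{e}_{r,m-r}(\tau)\,E_{k-m+2r}(\tau,s-r+j) = \Big(\frac i2\Big)^{m-j}\sum_{r=j}^m \binom{m-j}{r-j}\, r!\;E^{\mathrm{ahol}}_{k,m}(\tau,r,s-r+j).$$ Moreover, the function $s\mapsto E_{k,m}(\tau,j,s)$ has a meromorphic continuation to all of $\mathbb{C}$ (as a function with values in the polynomials of degree at most $m$), and its pole order at every point $s_0\in\mathbb{C}$ is at most $\max(1,\mu(s_0))$, where $\mu(s_0)\ge 0$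 is the multiplicity of $2s_0+k-m+2j$ as a zero of the Riemann zeta function $\zeta$. In particular, all its poles are at most simple, except possibly at points $s_0$ for which $2s_0+k-m+2j$ is a multiple zero of $\zeta$ (no multiple zero of $\zeta$ is known). -/

import Mathlib

open scoped MatrixGroups ModularForm
open UpperHalfPlane Polynomial

namespace VVEisenstein

noncomputable section

/-- The subgroup `Γ_∞ = {± T ^ n : n ∈ ℤ}` of `SL(2, ℤ)`. -/
def GammaInf : Subgroup SL(2, ℤ) where
  carrier := {γ | ∃ n : ℤ, γ = ModularGroup.T ^ n ∨ γ = -ModularGroup.T ^ n}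
  one_mem' := ⟨0, Or.inl (by simp)⟩
  mul_mem' := by
    rintro _ _ ⟨n, rfl | rfl⟩ ⟨l, rfl | rfl⟩
    · exact ⟨n + l, Or.inl (zpow_add _ _ _).symm⟩
    · exact ⟨n + l, Or.inr (by rw [zpow_add, mul_neg])⟩
    · exact ⟨n + l, Or.inr (by rw [zpow_add, neg_mul])⟩
    · exact ⟨n + l, Or.inl (by rw [zpow_add, neg_mul_neg])⟩
  inv_mem' := by
    rintro _ ⟨n, rfl | rfl⟩
    · exact ⟨-n, Or.inl (zpow_neg _ _).symm⟩
    · refine ⟨-n, Or.inr ?_⟩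
      rw [inv_eq_iff_mul_eq_one, neg_mul_neg, ← zpow_add]
      simp

/-- The set `Γ_∞ \ SL(2, ℤ)` of cosets `Γ_∞ γ`. -/
abbrev Cosets : Type := Quotient (QuotientGroup.rightRel GammaInf)

/-- The function `τ ↦ y ^ s` on the upper half plane, `y = Im τ`. -/
def yPow (s : ℂ) (τ : ℍ) : ℂ := (τ.im : ℂ) ^ s

/-- The right action of `γ = (a b; c d)` on polynomials of degree at most `m`,
`P(X) ↦ (c X + d) ^ m * P((a X + b) / (c X + d))`. -/
def symAct (m : ℕ) (γ : SL(2, ℤ)) (P : ℂ[X]) : ℂ[X] :=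
  ∑ i ∈ Finset.range (m + 1),
    C (P.coeff i) * (C (γ 0 0 : ℂ) * X + C (γ 0 1 : ℂ)) ^ i *
      (C (γ 1 0 : ℂ) * X + C (γ 1 1 : ℂ)) ^ (m - i)

/-- The slash action of weight `k` and type `sym ^ m` on functions with values in polynomials of
degree at most `m`,
`(f |_{k,m} γ)(τ)(X) = (c X + d) ^ m * (c τ + d) ^ (-k) * f(γ τ)(γ X)`. -/
def vslash (k : ℤ) (m : ℕ) (f : ℍ → ℂ[X]) (γ : SL(2, ℤ)) (τ : ℍ) : ℂ[X] :=
  C (((γ 1 0 : ℂ) * (τ : ℂ) + (γ 1 1 : ℂ)) ^ (-k)) * symAct m γ (f (γ • τ))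

/-- `𝔢_{r,l}(τ) = ((-1) ^ l / r!) * y ^ (-l) * (X - τ) ^ r * (X - conj τ) ^ l`. -/
def frakE (r l : ℕ) (τ : ℍ) : ℂ[X] :=
  C ((-1 : ℂ) ^ l / (r.factorial : ℂ) * ((τ.im : ℂ) ^ l)⁻¹) *
    (X - C (τ : ℂ)) ^ r * (X - C (starRingEnd ℂ (τ : ℂ))) ^ l

/-- The summand of the scalar-valued Eisenstein series at a coset `q = Γ_∞ γ`. For even `k` it does
not depend on the representative `γ` of `q`, see `slash_yPow_GammaInf_mul`. -/
def eisTerm (k : ℤ) (τ : ℍ) (s : ℂ) (q : Cosets) : ℂ := (yPow s ∣[k] q.out) τ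

/-- The real-analytic Eisenstein series `E_k(τ, s) = ∑_{γ ∈ Γ_∞ \ SL(2, ℤ)} (y ^ s |_k γ)(τ)`. -/
def eis (k : ℤ) (τ : ℍ) (s : ℂ) : ℂ := ∑' q : Cosets, eisTerm k τ s q

/-- The summand `((X - τ) ^ j y ^ s |_{k,m} γ)(τ)` at a coset `q = Γ_∞ γ`. For `k ≡ m` mod `2` it
does not depend on the representative `γ` of `q`, see `vslash_power_GammaInf_mul`. -/
def vEisTerm (k : ℤ) (m : ℕ) (τ : ℍ) (j : ℕ) (s : ℂ) (q : Cosets) : ℂ[X] :=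
  vslash k m (fun z ↦ C (yPow s z) * (X - C (z : ℂ)) ^ j) q.out τ

/-- The summand `(𝔢_{j,m-j} y ^ s |_{k,m} γ)(τ)` at a coset `q = Γ_∞ γ`. For `k ≡ m` mod `2` it
does not depend on the representative `γ` of `q`, see `vslash_frakE_GammaInf_mul`. -/
def aholEisTerm (k : ℤ) (m : ℕ) (τ : ℍ) (j : ℕ) (s : ℂ) (q : Cosets) : ℂ[X] :=
  vslash k m (fun z ↦ C (yPow s z) * frakE j (m - j) z) q.out τ

/-- Convergence of a series of polynomials, coefficient by coefficient. For a series in the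
finite-dimensional space of polynomials of degree at most `m`, this is absolute convergence. -/
def PolySummable {ι : Type} (f : ι → ℂ[X]) : Prop := ∀ i : ℕ, Summable fun q ↦ (f q).coeff i

/-- The sum, coefficient by coefficient, of a series of polynomials of degree at most `m`. -/
def polySum {ι : Type} (m : ℕ) (f : ι → ℂ[X]) : ℂ[X] :=
  ∑ i ∈ Finset.range (m + 1), monomial i (∑' q, (f q).coeff i)

/-- The vector-valued Eisenstein series
`E_{k,m}(τ, j, s) = ∑_{γ ∈ Γ_∞ \ SL(2, ℤ)} (X - τ) ^ j y ^ s |_{k,m} γ`. -/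
def vEis (k : ℤ) (m : ℕ) (τ : ℍ) (j : ℕ) (s : ℂ) : ℂ[X] := polySum m (vEisTerm k m τ j s)

/-- The Eisenstein series
`E^ahol_{k,m}(τ, j, s) = ∑_{γ ∈ Γ_∞ \ SL(2, ℤ)} 𝔢_{j,m-j} y ^ s |_{k,m} γ`. -/
def aholEis (k : ℤ) (m : ℕ) (τ : ℍ) (j : ℕ) (s : ℂ) : ℂ[X] := polySum m (aholEisTerm k m τ j s)

/-! ### The summands are well defined on cosets -/

lemma symAct_prod (r l e : ℕ) (γ : SL(2, ℤ)) (u v w : ℂ) :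
    symAct (r + l + e) γ (C u * (X - C v) ^ r * (X - C w) ^ l) =
      C u * ((C (γ 0 0 : ℂ) * X + C (γ 0 1 : ℂ)) - C v * (C (γ 1 0 : ℂ) * X + C (γ 1 1 : ℂ))) ^ r *
        ((C (γ 0 0 : ℂ) * X + C (γ 0 1 : ℂ)) - C w * (C (γ 1 0 : ℂ) * X + C (γ 1 1 : ℂ))) ^ l *
        (C (γ 1 0 : ℂ) * X + C (γ 1 1 : ℂ)) ^ e := by
  have key : ∀ (m : ℕ) (P : ℂ[X]), symAct m γ P =
      MvPolynomial.aeval ![(C (γ 0 0 : ℂ) * X + C (γ 0 1 : ℂ) : ℂ[X]),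
        C (γ 1 0 : ℂ) * X + C (γ 1 1 : ℂ)] (P.homogenize m) := by
    intro m P
    rw [symAct, Polynomial.homogenize, map_sum, Finset.Nat.sum_antidiagonal_eq_sum_range_succ_mk]
    refine Finset.sum_congr rfl fun i _ ↦ ?_
    rw [MvPolynomial.aeval_monomial, Finsupp.prod_fintype _ _ (by simp)]
    simp [Fin.prod_univ_two, mul_assoc]
  have lin : ∀ v : ℂ, (X - C v : ℂ[X]).homogenize 1 =
      MvPolynomial.X 0 - MvPolynomial.C v * MvPolynomial.X 1 := by
    intro v
    simp [Polynomial.homogenize_sub]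
  have pow : ∀ (v : ℂ) (n : ℕ), ((X - C v : ℂ[X]) ^ n).homogenize n =
      (MvPolynomial.X 0 - MvPolynomial.C v * MvPolynomial.X 1) ^ n := by
    intro v n
    induction n with
    | zero => simp
    | succ n ih =>
      rw [pow_succ, pow_succ, Polynomial.homogenize_mul _ _ (by simp) (by simp), ih, lin]
  rw [key]
  have h1 : (C u * (X - C v) ^ r * (X - C w) ^ l : ℂ[X]) =
      C u * ((X - C v) ^ r * (X - C w) ^ l * 1) := by ring
  rw [h1, Polynomial.homogenize_C_mul, Polynomial.homogenize_mul _ _ ?_ (by simp),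
    Polynomial.homogenize_mul _ _ (by simp) (by simp), pow, pow]
  · simp [mul_assoc]
  · refine (natDegree_mul_le).trans ?_
    simp

lemma GammaInf_mul_entries {δ : SL(2, ℤ)} (hδ : δ ∈ GammaInf) (γ : SL(2, ℤ)) :
    ∃ ε n : ℤ, (ε = 1 ∨ ε = -1) ∧
      (δ * γ) 0 0 = ε * (γ 0 0 + n * γ 1 0) ∧ (δ * γ) 0 1 = ε * (γ 0 1 + n * γ 1 1) ∧
      (δ * γ) 1 0 = ε * γ 1 0 ∧ (δ * γ) 1 1 = ε * γ 1 1 ∧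
      ∀ τ : ℍ, ((δ * γ) • τ : ℍ) = (n : ℝ) +ᵥ (γ • τ) := by
  have hT : ∀ (n : ℤ) (z : ℍ), ModularGroup.T ^ n • z = (n : ℝ) +ᵥ z := fun n z ↦
    modular_T_zpow_smul z n
  obtain ⟨n, rfl | rfl⟩ := hδ
  · refine ⟨1, n, Or.inl rfl, ?_, ?_, ?_, ?_, fun τ ↦ by rw [mul_smul, hT]⟩ <;>
      simp [Matrix.SpecialLinearGroup.coe_mul, ModularGroup.coe_T_zpow, Matrix.mul_apply]
  · have hM : ∀ a b : Fin 2, (-ModularGroup.T ^ n * γ) a b =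
        -((!![1, n; 0, 1] : Matrix (Fin 2) (Fin 2) ℤ) * (γ : Matrix (Fin 2) (Fin 2) ℤ)) a b := by
      intro a b
      rw [neg_mul, Matrix.SpecialLinearGroup.coe_neg, Matrix.SpecialLinearGroup.coe_mul,
        ModularGroup.coe_T_zpow, Matrix.neg_apply]
    refine ⟨-1, n, Or.inr rfl, ?_, ?_, ?_, ?_, fun τ ↦ ?_⟩
    · simp only [hM]
      simp [Matrix.mul_apply]; try ring
    · simp only [hM]
      simp [Matrix.mul_apply]; try ring
    · simp only [hM]
      simp [Matrix.mul_apply]; try ring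
    · simp only [hM]
      simp [Matrix.mul_apply]
    · rw [neg_mul, ModularGroup.SL_neg_smul, mul_smul, hT]

lemma slash_yPow_GammaInf_mul {k : ℤ} (hk : Even k) (s : ℂ) {δ : SL(2, ℤ)} (hδ : δ ∈ GammaInf)
    (γ : SL(2, ℤ)) : yPow s ∣[k] (δ * γ) = yPow s ∣[k] γ := by
  obtain ⟨ε, n, hε, -, -, h10, h11, hsm⟩ := GammaInf_mul_entries hδ γ
  funext τ
  have hd : ∀ g : SL(2, ℤ), denom g τ = (g 1 0 : ℂ) * τ + (g 1 1 : ℂ) := fun g ↦ by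
    simp [denom]
  rw [ModularForm.SL_slash_apply, ModularForm.SL_slash_apply, hsm, hd, hd, h10, h11]
  have him : yPow s ((n : ℝ) +ᵥ (γ • τ)) = yPow s (γ • τ) := by simp [yPow]
  rw [him]
  congr 1
  rcases hε with rfl | rfl
  · simp
  · rw [← Even.neg_zpow hk.neg]
    congr 1
    push_cast
    ring

lemma vslash_prod_GammaInf_mul {k : ℤ} {r l e : ℕ} (hk : k ≡ ((r + l + e : ℕ) : ℤ) [ZMOD 2])
    (u : ℝ → ℂ) {δ : SL(2, ℤ)} (hδ : δ ∈ GammaInf) (γ : SL(2, ℤ)) (τ : ℍ) :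
    vslash k (r + l + e) (fun z ↦ C (u z.im) * (X - C (z : ℂ)) ^ r *
      (X - C (starRingEnd ℂ (z : ℂ))) ^ l) (δ * γ) τ =
    vslash k (r + l + e) (fun z ↦ C (u z.im) * (X - C (z : ℂ)) ^ r *
      (X - C (starRingEnd ℂ (z : ℂ))) ^ l) γ τ := by
  obtain ⟨ε, n, hε, h00, h01, h10, h11, hsm⟩ := GammaInf_mul_entries hδ γ
  have hpar : (ε : ℂ) ^ (-k) * ((ε : ℂ) ^ r * (ε : ℂ) ^ l * (ε : ℂ) ^ e) = 1 := by
    rw [← pow_add, ← pow_add]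
    rcases hε with rfl | rfl
    · simp
    · rw [← zpow_natCast, ← zpow_add₀ (by simp)]
      have : Even (-k + ((r + l + e : ℕ) : ℤ)) := by
        rw [Int.even_iff]
        have := hk.eq
        omega
      rw [Int.cast_neg, Int.cast_one]
      exact this.neg_one_zpow
  simp only [vslash, symAct_prod, hsm, h00, h01, h10, h11]
  generalize γ • τ = z
  have e1 : (C ((ε * (γ 0 0 + n * γ 1 0) : ℤ) : ℂ) * X + C ((ε * (γ 0 1 + n * γ 1 1) : ℤ) : ℂ)) -
      C ((((n : ℝ) +ᵥ z : ℍ)) : ℂ) *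
        (C ((ε * γ 1 0 : ℤ) : ℂ) * X + C ((ε * γ 1 1 : ℤ) : ℂ)) =
      C (ε : ℂ) * ((C (γ 0 0 : ℂ) * X + C (γ 0 1 : ℂ)) -
        C (z : ℂ) * (C (γ 1 0 : ℂ) * X + C (γ 1 1 : ℂ))) := by
    simp only [coe_vadd, map_add, map_mul, Int.cast_mul, Int.cast_add, Complex.ofReal_intCast]
    ring
  have e2 : (C ((ε * (γ 0 0 + n * γ 1 0) : ℤ) : ℂ) * X + C ((ε * (γ 0 1 + n * γ 1 1) : ℤ) : ℂ)) -
      C (starRingEnd ℂ ((((n : ℝ) +ᵥ z : ℍ)) : ℂ)) *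
        (C ((ε * γ 1 0 : ℤ) : ℂ) * X + C ((ε * γ 1 1 : ℤ) : ℂ)) =
      C (ε : ℂ) * ((C (γ 0 0 : ℂ) * X + C (γ 0 1 : ℂ)) -
        C (starRingEnd ℂ (z : ℂ)) * (C (γ 1 0 : ℂ) * X + C (γ 1 1 : ℂ))) := by
    simp only [coe_vadd, map_add, map_mul, Int.cast_mul, Int.cast_add,
      Complex.ofReal_intCast, map_intCast]
    ring
  have e3 : C ((ε * γ 1 0 : ℤ) : ℂ) * X + C ((ε * γ 1 1 : ℤ) : ℂ) =
      C (ε : ℂ) * (C (γ 1 0 : ℂ) * X + C (γ 1 1 : ℂ)) := by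
    simp only [map_mul, Int.cast_mul]
    ring
  have e4 : ((ε * γ 1 0 : ℤ) : ℂ) * (τ : ℂ) + ((ε * γ 1 1 : ℤ) : ℂ) =
      (ε : ℂ) * ((γ 1 0 : ℂ) * (τ : ℂ) + (γ 1 1 : ℂ)) := by
    push_cast
    ring
  rw [e1, e2, e3, e4, vadd_im]
  have hC := congrArg (C : ℂ → ℂ[X]) hpar
  simp only [map_mul, map_pow, map_one] at hC
  rw [mul_zpow, C_mul]
  simp only [mul_pow]
  linear_combination (C (((γ 1 0 : ℂ) * (τ : ℂ) + (γ 1 1 : ℂ)) ^ (-k)) * (C (u z.im) *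
    ((C (γ 0 0 : ℂ) * X + C (γ 0 1 : ℂ)) - C (z : ℂ) *
      (C (γ 1 0 : ℂ) * X + C (γ 1 1 : ℂ))) ^ r *
    ((C (γ 0 0 : ℂ) * X + C (γ 0 1 : ℂ)) - C (starRingEnd ℂ (z : ℂ)) *
      (C (γ 1 0 : ℂ) * X + C (γ 1 1 : ℂ))) ^ l *
    (C (γ 1 0 : ℂ) * X + C (γ 1 1 : ℂ)) ^ e)) * hC

lemma vslash_power_GammaInf_mul {k : ℤ} {m j : ℕ} (hk : k ≡ m [ZMOD 2]) (hj : j ≤ m) (s : ℂ)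
    {δ : SL(2, ℤ)} (hδ : δ ∈ GammaInf) (γ : SL(2, ℤ)) (τ : ℍ) :
    vslash k m (fun z ↦ C (yPow s z) * (X - C (z : ℂ)) ^ j) (δ * γ) τ =
      vslash k m (fun z ↦ C (yPow s z) * (X - C (z : ℂ)) ^ j) γ τ := by
  obtain ⟨e, rfl⟩ := Nat.exists_eq_add_of_le hj
  have := vslash_prod_GammaInf_mul (k := k) (r := j) (l := 0) (e := e) (by simpa using hk)
    (fun y ↦ (y : ℂ) ^ s) hδ γ τ
  simpa [yPow] using this

lemma vslash_frakE_GammaInf_mul {k : ℤ} {m j : ℕ} (hk : k ≡ m [ZMOD 2]) (hj : j ≤ m) (s : ℂ)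
    {δ : SL(2, ℤ)} (hδ : δ ∈ GammaInf) (γ : SL(2, ℤ)) (τ : ℍ) :
    vslash k m (fun z ↦ C (yPow s z) * frakE j (m - j) z) (δ * γ) τ =
      vslash k m (fun z ↦ C (yPow s z) * frakE j (m - j) z) γ τ := by
  obtain ⟨e, rfl⟩ := Nat.exists_eq_add_of_le hj
  have := vslash_prod_GammaInf_mul (k := k) (r := j) (l := e) (e := 0) (by simpa using hk)
    (fun y ↦ (y : ℂ) ^ s * ((-1 : ℂ) ^ e / (j.factorial : ℂ) * ((y : ℂ) ^ e)⁻¹)) hδ γ τ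
  simpa only [yPow, frakE, Nat.add_sub_cancel_left, C_mul, mul_assoc, add_zero] using this

end

end VVEisenstein

namespace VVEisenstein

noncomputable section

/-! Write J = cτ + d. The expansion is a termwise identity: cX + d takes the values J and its
conjugate at τ and its conjugate, hence is a combination of X − τ and X − conj τ
(`bottom_linear_eq`). The binomial theorem for (cX + d)^(m−j) then splits each summand into products
of `frakE` with scalar Eisenstein summands (`vEisTerm_eq`, `aholEisTerm_eq`). Everything reduces to
scalar series.

For these, sorting lattice vectors by gcd gives ∑ J^(−k) (y/|J|²)^s = 2 ζ(2s+k) E_k(τ,s)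
(`summable_eisTerm_and_tsum`). For k = −n ≤ 0 the lattice sum is, up to π^s/Γ(s), the Mellin
transform of a theta function with polynomial J^n. The functional equations for all n come at once
from one Poisson summation with a parameter w, by comparing coefficients of w^n (`tsum_expTerm_inv`,
`theta_inv`). Positive weights follow by τ ↦ −conj τ. Thus E_k(τ,s) = H(z)/((z−2)ζ(z)) with z = 2s+k
and H entire (`exists_entire_eis`).

Finally, z has the same value 2s+k−m+2j for every r in the expansion, so all terms share one
denominator. Its zero at z = 2 is simple and disjoint from the zeros of ζ, which yields max(1, μ).
-/

/-- The summand `J ^ (-k) * (y / |J| ^ 2) ^ s`, `J = c τ + d`, of the Eisenstein series, at an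
arbitrary pair `(c, d)`. -/
def latticeTerm (k : ℤ) (τ : ℍ) (s : ℂ) (v : ℤ × ℤ) : ℂ :=
  ((v.1 : ℂ) * τ + v.2) ^ (-k) * ((τ.im / Complex.normSq ((v.1 : ℂ) * τ + v.2) : ℝ) : ℂ) ^ s

/-! ### Slash action on products of linear factors and the termwise expansion -/

lemma denom_coe (γ : SL(2, ℤ)) (τ : ℍ) : denom γ τ = (γ 1 0 : ℂ) * τ + (γ 1 1 : ℂ) := by
  simp [denom]

lemma bottom_ne_zero (γ : SL(2, ℤ)) (τ : ℍ) : (γ 1 0 : ℂ) * τ + (γ 1 1 : ℂ) ≠ 0 := by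
  rw [← denom_coe]; exact denom_ne_zero _ _

lemma im_smul_eq (γ : SL(2, ℤ)) (τ : ℍ) :
    (γ • τ).im = τ.im / Complex.normSq ((γ 1 0 : ℂ) * τ + (γ 1 1 : ℂ)) := by
  rw [ModularGroup.im_smul_eq_div_normSq, denom_coe]

lemma eisTerm_eq (k : ℤ) (τ : ℍ) (s : ℂ) (q : Cosets) :
    eisTerm k τ s q = latticeTerm k τ s (q.out 1 0, q.out 1 1) := by
  rw [eisTerm, ModularForm.SL_slash_apply, yPow, im_smul_eq, denom_coe, latticeTerm, mul_comm]

lemma smul_coe_eq (γ : SL(2, ℤ)) (τ : ℍ) : ((γ • τ : ℍ) : ℂ) =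
    ((γ 0 0 : ℂ) * τ + (γ 0 1 : ℂ)) / ((γ 1 0 : ℂ) * τ + (γ 1 1 : ℂ)) := by
  rw [specialLinearGroup_apply]; simp

lemma det_coe (γ : SL(2, ℤ)) : (γ 0 0 : ℂ) * γ 1 1 - (γ 0 1 : ℂ) * γ 1 0 = 1 := by
  have := γ.det_coe
  rw [Matrix.det_fin_two] at this
  exact_mod_cast this

/-- The left side is linear in X with root z, and its leading coefficient a − c·γz is 1/(cz+d)
because the determinant is 1. -/
lemma linear_sub_C_mul_linear (γ : SL(2, ℤ)) {z : ℂ} (hz : (γ 1 0 : ℂ) * z + (γ 1 1 : ℂ) ≠ 0) :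
    (C (γ 0 0 : ℂ) * X + C (γ 0 1 : ℂ)) -
      C (((γ 0 0 : ℂ) * z + (γ 0 1 : ℂ)) / ((γ 1 0 : ℂ) * z + (γ 1 1 : ℂ))) *
        (C (γ 1 0 : ℂ) * X + C (γ 1 1 : ℂ)) =
      C ((γ 1 0 : ℂ) * z + (γ 1 1 : ℂ))⁻¹ * (X - C z) := by
  have h : C ((γ 1 0 : ℂ) * z + (γ 1 1 : ℂ))⁻¹ * C ((γ 1 0 : ℂ) * z + (γ 1 1 : ℂ)) = 1 := by
    rw [← C_mul, inv_mul_cancel₀ hz, C_1]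
  have hd := congrArg (C : ℂ → ℂ[X]) (det_coe γ)
  rw [div_eq_mul_inv, C_mul]
  simp only [map_sub, map_mul, map_add, map_one] at hd h ⊢
  linear_combination (C (((γ 1 0 : ℂ) * z + (γ 1 1 : ℂ))⁻¹) * (X - C z)) * hd -
    (C (γ 0 0 : ℂ) * X + C (γ 0 1 : ℂ)) * h

lemma conj_smul_coe_eq (γ : SL(2, ℤ)) (τ : ℍ) : starRingEnd ℂ ((γ • τ : ℍ) : ℂ) =
    ((γ 0 0 : ℂ) * starRingEnd ℂ (τ : ℂ) + (γ 0 1 : ℂ)) /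
      ((γ 1 0 : ℂ) * starRingEnd ℂ (τ : ℂ) + (γ 1 1 : ℂ)) := by
  rw [smul_coe_eq]; simp

lemma conj_bottom (γ : SL(2, ℤ)) (τ : ℍ) :
    (γ 1 0 : ℂ) * starRingEnd ℂ (τ : ℂ) + (γ 1 1 : ℂ) =
      starRingEnd ℂ ((γ 1 0 : ℂ) * τ + (γ 1 1 : ℂ)) := by
  simp

/-- Since γ is real, it carries conj τ to conj(γτ), so both kinds of linear factor transform by the
same rule; only the power of cX + d completing the degree remains. -/
lemma vslash_prod (k : ℤ) (r l e : ℕ) (u : ℍ → ℂ) (γ : SL(2, ℤ)) (τ : ℍ) :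
    vslash k (r + l + e) (fun z ↦ C (u z) * (X - C (z : ℂ)) ^ r *
      (X - C (starRingEnd ℂ (z : ℂ))) ^ l) γ τ =
    C (((γ 1 0 : ℂ) * τ + γ 1 1) ^ (-k) * u (γ • τ) * (((γ 1 0 : ℂ) * τ + γ 1 1) ^ r)⁻¹ *
      ((starRingEnd ℂ ((γ 1 0 : ℂ) * τ + γ 1 1)) ^ l)⁻¹) *
      (X - C (τ : ℂ)) ^ r * (X - C (starRingEnd ℂ (τ : ℂ))) ^ l *
      (C (γ 1 0 : ℂ) * X + C (γ 1 1 : ℂ)) ^ e := by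
  have h1 := bottom_ne_zero γ τ
  have h2 : (γ 1 0 : ℂ) * starRingEnd ℂ (τ : ℂ) + (γ 1 1 : ℂ) ≠ 0 := by
    rw [conj_bottom]; exact (map_ne_zero (starRingEnd ℂ)).mpr h1
  rw [vslash, symAct_prod, conj_smul_coe_eq, linear_sub_C_mul_linear γ h2, smul_coe_eq,
    linear_sub_C_mul_linear γ h1, conj_bottom, ← inv_pow, ← inv_pow]
  simp only [mul_pow, C_mul, C_pow]
  ring

/-- Here no power of cX + d is left over. The factor y^(−l) contributes |J|^(2l), which cancels
conj(J)^(−l) and leaves J^l; this accounts for the weight k + r − l = k − m + 2r. -/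
lemma aholEisTerm_eq (k : ℤ) {m r : ℕ} (hr : r ≤ m) (τ : ℍ) (s : ℂ) (q : Cosets) :
    aholEisTerm k m τ r s q = frakE r (m - r) τ * C (eisTerm (k - m + 2 * r) τ s q) := by
  obtain ⟨l, rfl⟩ := Nat.exists_eq_add_of_le hr
  have hJ := bottom_ne_zero q.out τ
  have h := vslash_prod k r l 0 (fun z ↦ yPow s z * ((-1 : ℂ) ^ l / (r.factorial : ℂ) *
    ((z.im : ℂ) ^ l)⁻¹)) q.out τ
  rw [aholEisTerm, Nat.add_sub_cancel_left]
  simp only [frakE, ← mul_assoc, ← C_mul, add_zero, pow_zero, mul_one] at h ⊢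
  rw [h, eisTerm, ModularForm.SL_slash_apply, denom_coe, im_smul_eq]
  set J := (q.out 1 0 : ℂ) * τ + q.out 1 1 with hJd
  have hy : (τ.im : ℂ) ≠ 0 := by exact_mod_cast τ.im_pos.ne'
  have hcJ : starRingEnd ℂ J ≠ 0 := by simpa using hJ
  have e : J ^ (-k) * (J ^ r)⁻¹ * ((starRingEnd ℂ J) ^ l)⁻¹ *
      (((τ.im / Complex.normSq J : ℝ) : ℂ) ^ l)⁻¹ =
      ((τ.im : ℂ) ^ l)⁻¹ * J ^ (-(k - (r + l : ℕ) + 2 * r)) := by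
    have e1 : J ^ (-(k - (r + l : ℕ) + 2 * r)) = J ^ (-k) * (J ^ r)⁻¹ * J ^ l := by
      rw [← zpow_natCast, ← zpow_natCast, ← zpow_neg, ← zpow_add₀ hJ, ← zpow_add₀ hJ]
      congr 1
      push_cast
      ring
    rw [e1, Complex.ofReal_div, ← Complex.mul_conj, div_pow, mul_pow]
    field_simp
  have e' : J ^ (-k) * (yPow s (q.out • τ) * ((-1) ^ l / (r.factorial : ℂ) *
      (((τ.im / Complex.normSq J : ℝ) : ℂ) ^ l)⁻¹)) * (J ^ r)⁻¹ * (starRingEnd ℂ J ^ l)⁻¹ =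
      (-1) ^ l / (r.factorial : ℂ) * ((τ.im : ℂ) ^ l)⁻¹ * (yPow s (q.out • τ) *
        J ^ (-(k - (r + l : ℕ) + 2 * r))) := by
    linear_combination (yPow s (q.out • τ) * ((-1) ^ l / (r.factorial : ℂ))) * e
  simp only [← mul_assoc] at e' ⊢
  rw [e']
  simp only [C_mul]
  ring

/-- Interpolation of a linear polynomial at τ and conj τ; the constant i/(2y) is −1/(τ − conj τ). -/
lemma bottom_linear_eq (γ : SL(2, ℤ)) (τ : ℍ) :
    C (γ 1 0 : ℂ) * X + C (γ 1 1 : ℂ) = C (Complex.I / 2 * (τ.im : ℂ)⁻¹) *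
      (C (starRingEnd ℂ ((γ 1 0 : ℂ) * τ + γ 1 1)) * (X - C (τ : ℂ)) +
      -C ((γ 1 0 : ℂ) * τ + γ 1 1) * (X - C (starRingEnd ℂ (τ : ℂ)))) := by
  have hy : (τ.im : ℂ) ≠ 0 := by exact_mod_cast τ.im_pos.ne'
  have h1 : (τ : ℂ) - starRingEnd ℂ (τ : ℂ) = 2 * τ.im * Complex.I := by
    rw [Complex.sub_conj]; simp
  have h3 : (Complex.I / 2 * (τ.im : ℂ)⁻¹) * ((τ : ℂ) - starRingEnd ℂ (τ : ℂ)) = -1 := by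
    rw [h1]
    field_simp
    linear_combination Complex.I_sq
  have h2 := congrArg (C : ℂ → ℂ[X]) h3
  simp only [map_mul, map_sub, map_add, map_neg, map_one, map_intCast] at h2 ⊢
  linear_combination ((γ 1 0 : ℂ[X]) * X + (γ 1 1 : ℂ[X])) * h2

/-- The binomial term with index p = r − j carries conj(J)^p. Lowering s by p produces
(y/|J|²)^(−p), which supplies that factor along with J^p, and the latter is absorbed by the weight.
-/
lemma vEisTerm_eq (k : ℤ) {m j : ℕ} (hj : j ≤ m) (τ : ℍ) (s : ℂ) (q : Cosets) :
    vEisTerm k m τ j s q = C ((Complex.I / 2) ^ (m - j)) * ∑ r ∈ Finset.Icc j m,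
      C (((m - j).choose (r - j) : ℂ) * (r.factorial : ℂ)) *
        (frakE r (m - r) τ * C (eisTerm (k - m + 2 * r) τ (s - r + j) q)) := by
  obtain ⟨e, rfl⟩ := Nat.exists_eq_add_of_le hj
  have hJ := bottom_ne_zero q.out τ
  have h := vslash_prod k j 0 e (yPow s) q.out τ
  simp only [pow_zero, mul_one, add_zero] at h
  rw [bottom_linear_eq q.out τ] at h
  rw [vEisTerm, h]
  generalize hJd : (q.out 1 0 : ℂ) * τ + q.out 1 1 = J at hJ
  rw [mul_pow, add_pow (C (starRingEnd ℂ J) * _), Nat.add_sub_cancel_left,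
    Finset.mul_sum, Finset.mul_sum, Finset.mul_sum,
    show Finset.Icc j (j + e) = (Finset.range (e + 1)).map (addLeftEmbedding j) by
      ext i
      simp only [Finset.mem_Icc, Finset.mem_map, Finset.mem_range, addLeftEmbedding_apply]
      constructor
      · rintro ⟨h1, h2⟩
        exact ⟨i - j, by omega, by omega⟩
      · rintro ⟨a, h1, rfl⟩
        omega, Finset.sum_map]
  refine Finset.sum_congr rfl fun p hp ↦ ?_
  obtain ⟨l, rfl⟩ := Nat.exists_eq_add_of_le (Nat.lt_succ_iff.mp (Finset.mem_range.mp hp))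
  rw [addLeftEmbedding_apply, Nat.add_sub_cancel_left, show j + (p + l) - (j + p) = l by omega,
    Nat.add_sub_cancel_left, eisTerm, ModularForm.SL_slash_apply, denom_coe, hJd, frakE, yPow, yPow,
    im_smul_eq, hJd]
  have hy : (τ.im : ℂ) ≠ 0 := by exact_mod_cast τ.im_pos.ne'
  have hcJ : starRingEnd ℂ J ≠ 0 := by simpa using hJ
  have hfac : (((j + p).factorial : ℕ) : ℂ) ≠ 0 := by exact_mod_cast Nat.factorial_ne_zero _
  have hY : ((τ.im / Complex.normSq J : ℝ) : ℂ) ≠ 0 := by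
    exact_mod_cast (div_pos τ.im_pos (Complex.normSq_pos.mpr hJ)).ne'
  have e0 : ((τ.im / Complex.normSq J : ℝ) : ℂ) ^ (s - (j + p : ℕ) + j) =
      ((τ.im / Complex.normSq J : ℝ) : ℂ) ^ s * (((τ.im / Complex.normSq J : ℝ) : ℂ) ^ p)⁻¹ := by
    rw [show s - (j + p : ℕ) + j = s - (p : ℕ) by push_cast; ring, Complex.cpow_sub _ _ hY,
      Complex.cpow_natCast, div_eq_mul_inv]
  have e1 : J ^ (-(k - (j + (p + l) : ℕ) + 2 * (j + p : ℕ))) =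
      J ^ (-k) * (J ^ j)⁻¹ * (J ^ p)⁻¹ * J ^ l := by
    rw [← zpow_natCast, ← zpow_natCast, ← zpow_natCast, ← zpow_neg, ← zpow_neg, ← zpow_add₀ hJ,
      ← zpow_add₀ hJ, ← zpow_add₀ hJ]
    congr 1
    push_cast
    ring
  have e2 : (((τ.im / Complex.normSq J : ℝ) : ℂ) ^ p)⁻¹ =
      J ^ p * (starRingEnd ℂ J) ^ p * ((τ.im : ℂ) ^ p)⁻¹ := by
    rw [Complex.ofReal_div, ← Complex.mul_conj, div_pow, inv_div, mul_pow, div_eq_mul_inv]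
  rw [e0, e1, e2]
  set A := ((τ.im / Complex.normSq J : ℝ) : ℂ) ^ s
  have key : J ^ (-k) * A * (J ^ j)⁻¹ * (Complex.I / 2 * (τ.im : ℂ)⁻¹) ^ (p + l) *
      ((starRingEnd ℂ J) ^ p * (-1) ^ l * J ^ l) * ((p + l).choose p) =
      (Complex.I / 2) ^ (p + l) * ((((p + l).choose p) * ((j + p).factorial : ℂ)) *
      (((-1 : ℂ) ^ l / ((j + p).factorial : ℂ) * ((τ.im : ℂ) ^ l)⁻¹) *
      (A * (J ^ p * (starRingEnd ℂ J) ^ p * ((τ.im : ℂ) ^ p)⁻¹) *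
        (J ^ (-k) * (J ^ j)⁻¹ * (J ^ p)⁻¹ * J ^ l)))) := by
    rw [mul_pow, inv_pow, pow_add (τ.im : ℂ)]
    generalize J ^ (-k) = B
    field_simp
  have hk := congrArg (C : ℂ → ℂ[X]) key
  simp only [mul_pow, neg_pow (C J), C_mul, C_pow, C_neg, C_1, pow_add, map_natCast, inv_one]
    at hk ⊢
  linear_combination ((X - C (τ : ℂ)) ^ j * (X - C (τ : ℂ)) ^ p *
    (X - C (starRingEnd ℂ (τ : ℂ))) ^ l) * hk

/-! ### Nonzero lattice vectors as signed multiples of coset bottom rows -/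

lemma mem_GammaInf_of_bottom {γ : SL(2, ℤ)} (h : γ 1 0 = 0) : γ ∈ GammaInf := by
  have hdet := γ.det_coe
  rw [Matrix.det_fin_two, h, mul_zero, sub_zero] at hdet
  rcases Int.eq_one_or_neg_one_of_mul_eq_one' hdet with ⟨h0, h1⟩ | ⟨h0, h1⟩
  · refine ⟨γ 0 1, Or.inl ?_⟩
    ext i j
    rw [ModularGroup.coe_T_zpow]
    fin_cases i <;> fin_cases j <;> simp [h0, h1, h]
  · refine ⟨-γ 0 1, Or.inr ?_⟩
    ext i j
    rw [Matrix.SpecialLinearGroup.coe_neg, Matrix.neg_apply, ModularGroup.coe_T_zpow]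
    fin_cases i <;> fin_cases j <;> simp [h0, h1, h]

/-- Proportional bottom rows make the quotient of the two representatives upper triangular. -/
lemma coset_eq_of_bottom {q q' : Cosets} (h : q.out 1 0 * q'.out 1 1 = q.out 1 1 * q'.out 1 0) :
    q = q' := by
  rw [← Quotient.out_equiv_out]
  change QuotientGroup.rightRel GammaInf _ _
  rw [QuotientGroup.rightRel_apply]
  apply mem_GammaInf_of_bottom
  rw [Matrix.SpecialLinearGroup.coe_mul, Matrix.mul_apply, Fin.sum_univ_two,
    Matrix.SpecialLinearGroup.SL2_inv_expl]
  simp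
  linarith

/-- The pair `±n (c, d)`, where `(c, d)` is the bottom row of a representative of a coset. -/
def cosetPair (x : Cosets × (ℤˣ × ℕ+)) : ℤ × ℤ :=
  ((x.2.1 : ℤ) * (x.2.2 : ℕ) * x.1.out 1 0, (x.2.1 : ℤ) * (x.2.2 : ℕ) * x.1.out 1 1)

lemma gcd_bottom (γ : SL(2, ℤ)) : Int.gcd (γ 1 0) (γ 1 1) = 1 :=
  Int.isCoprime_iff_gcd_eq_one.mp (ModularGroup.bottom_row_coprime γ)

lemma gcd_cosetPair (x : Cosets × (ℤˣ × ℕ+)) :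
    Int.gcd (cosetPair x).1 (cosetPair x).2 = x.2.2 := by
  rw [cosetPair, Int.gcd_mul_left, gcd_bottom]
  simp [Int.natAbs_mul]

/-- The gcd recovers n, proportionality of the rows recovers the coset, and a Bézout relation for
the coprime row recovers the sign. -/
lemma cosetPair_injective : Function.Injective cosetPair := by
  rintro ⟨q, u, n⟩ ⟨q', u', n'⟩ h
  have hn : n = n' := by
    have := gcd_cosetPair ⟨q, u, n⟩
    rw [h, gcd_cosetPair] at this
    exact PNat.coe_injective this.symm
  subst hn
  simp only [cosetPair, Prod.mk.injEq] at h
  obtain ⟨h1, h2⟩ := h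
  have hn0 : ((n : ℕ) : ℤ) ≠ 0 := by exact_mod_cast n.ne_zero
  have hu0 : (u : ℤ) ≠ 0 := u.ne_zero
  have hu0' : (u' : ℤ) ≠ 0 := u'.ne_zero
  have hq : q = q' := by
    apply coset_eq_of_bottom
    apply mul_left_cancel₀ (mul_ne_zero (mul_ne_zero hu0 hn0) (mul_ne_zero hu0' hn0))
    linear_combination (u' : ℤ) * n * q'.out 1 1 * h1 - (u' : ℤ) * n * q'.out 1 0 * h2
  subst hq
  have hu : u = u' := by
    ext
    obtain ⟨a, b, hab⟩ := ModularGroup.bottom_row_coprime q.out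
    apply mul_right_cancel₀ hn0
    linear_combination a * h1 + b * h2 + ((u' : ℤ) * n - u * n) * hab
  rw [hu]

lemma mem_range_cosetPair {v : ℤ × ℤ} (hv : v ≠ 0) : v ∈ Set.range cosetPair := by
  obtain ⟨c, d⟩ := v
  have hg : 0 < Int.gcd c d := by
    rw [Int.gcd_pos_iff]
    by_contra! h
    exact hv (by simp [h.1, h.2])
  obtain ⟨c', d', hcop, hc, hd⟩ := Int.exists_gcd_one hg
  obtain ⟨γ, -, hγ⟩ := ModularGroup.bottom_row_surj
    (show ![c', d'] ∈ {cd : Fin 2 → ℤ | IsCoprime (cd 0) (cd 1)} by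
      simpa using Int.isCoprime_iff_gcd_eq_one.mpr hcop)
  have h0 : γ 1 0 = c' := congrFun hγ 0
  have h1 : γ 1 1 = d' := congrFun hγ 1
  set q : Cosets := Quotient.mk _ γ
  -- The chosen representative of the coset of γ may have the opposite bottom row, so its sign ε is
  -- used as the unit and cancels by ε² = 1.
  have hq : QuotientGroup.rightRel GammaInf γ q.out := Quotient.exact (Quotient.out_eq q).symm
  rw [QuotientGroup.rightRel_apply] at hq
  obtain ⟨ε, n, hε, -, -, h10, h11, -⟩ := GammaInf_mul_entries hq γ
  rw [inv_mul_cancel_right] at h10 h11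
  have hε' : IsUnit ε := Int.isUnit_iff.mpr hε
  refine ⟨⟨q, hε'.unit, ⟨Int.gcd c d, hg⟩⟩, ?_⟩
  have hεε : ε * ε = 1 := Int.isUnit_mul_self hε'
  simp only [cosetPair, IsUnit.unit_spec, PNat.mk_coe, h10, h11, h0, h1]
  refine Prod.ext ?_ ?_
  · change ε * _ * (ε * c') = c
    linear_combination (Int.gcd c d : ℤ) * c' * hεε - hc
  · change ε * _ * (ε * d') = d
    linear_combination (Int.gcd c d : ℤ) * d' * hεε - hd

/-! ### Absolute convergence and the factor 2ζ(2s+k) -/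

lemma linear_ne_zero_of_ne_zero (τ : ℍ) {v : ℤ × ℤ} (hv : v ≠ 0) :
    (v.1 : ℂ) * τ + v.2 ≠ 0 := by
  have := linear_ne_zero (cd := ![(v.1 : ℝ), (v.2 : ℝ)]) τ (by
    intro h
    apply hv
    have h0 := congrFun h 0
    have h1 := congrFun h 1
    simp at h0 h1
    exact Prod.ext h0 h1)
  simpa using this

lemma summable_norm_linear_rpow (τ : ℍ) {p : ℝ} (hp : 2 < p) :
    Summable fun v : ℤ × ℤ ↦ ‖(v.1 : ℂ) * τ + v.2‖ ^ (-p) := by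
  have h : Summable fun x : Fin 2 → ℤ ↦ ‖(x 0 : ℂ) * τ + x 1‖ ^ (-p) :=
    Summable.of_nonneg_of_le (fun _ ↦ by positivity)
      (fun x ↦ EisensteinSeries.summand_bound τ (by linarith) x)
      ((EisensteinSeries.summable_one_div_norm_rpow hp).mul_left _)
  exact ((finTwoArrowEquiv ℤ).symm.summable_iff.mpr h).congr fun v ↦ by simp

lemma norm_latticeTerm (k : ℤ) (τ : ℍ) (s : ℂ) {v : ℤ × ℤ} (hv : v ≠ 0) :
    ‖latticeTerm k τ s v‖ = τ.im ^ s.re * ‖(v.1 : ℂ) * τ + v.2‖ ^ (-(2 * s.re + k)) := by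
  have hJ := norm_pos_iff.mpr (linear_ne_zero_of_ne_zero τ hv)
  rw [latticeTerm, Complex.normSq_eq_norm_sq, norm_mul, norm_zpow,
    Complex.norm_cpow_eq_rpow_re_of_pos (div_pos τ.im_pos (pow_pos hJ 2)),
    Real.div_rpow τ.im_pos.le (by positivity), ← Real.rpow_natCast, ← Real.rpow_mul hJ.le,
    ← Real.rpow_intCast, div_eq_mul_inv, ← Real.rpow_neg hJ.le, mul_left_comm,
    ← Real.rpow_add hJ]
  congr 2
  push_cast
  ring

/-- Lets sums run over all of ℤ². With total powers the origin gives 0 through the first factor if k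
≠ 0, and through 0^s if k = 0, where the bound on s forces s ≠ 0. -/
lemma latticeTerm_zero {k : ℤ} (τ : ℍ) {s : ℂ} (hs : 2 < 2 * s.re + k) :
    latticeTerm k τ s 0 = 0 := by
  rcases eq_or_ne k 0 with rfl | hk
  · have : s ≠ 0 := by
      rintro rfl
      norm_num at hs
    simp [latticeTerm, this]
  · simp [latticeTerm, zero_zpow _ (neg_ne_zero.mpr hk)]

lemma summable_norm_latticeTerm {k : ℤ} (τ : ℍ) {s : ℂ} (hs : 2 < 2 * s.re + k) :
    Summable fun v ↦ ‖latticeTerm k τ s v‖ := by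
  refine Summable.of_nonneg_of_le (fun _ ↦ norm_nonneg _) (fun v ↦ ?_)
    ((summable_norm_linear_rpow τ hs).mul_left (τ.im ^ s.re))
  rcases eq_or_ne v 0 with rfl | hv
  · rw [latticeTerm_zero τ hs, norm_zero]
    have := τ.im_pos
    positivity
  · exact (norm_latticeTerm k τ s hv).le

/-- Homogeneity: replacing J by ±nJ gives the factor n^(−2s−k), and the sign disappears because k is
even. -/
lemma latticeTerm_cosetPair {k : ℤ} (hk : Even k) (τ : ℍ) (s : ℂ) (x : Cosets × (ℤˣ × ℕ+)) :
    latticeTerm k τ s (cosetPair x) = eisTerm k τ s x.1 * (1 / (x.2.2 : ℂ) ^ (2 * s + k)) := by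
  obtain ⟨q, u, n⟩ := x
  rw [eisTerm_eq]
  have hJ := bottom_ne_zero q.out τ
  simp only [cosetPair, latticeTerm]
  generalize hJd : (q.out 1 0 : ℂ) * τ + q.out 1 1 = J at hJ
  have hn : (0 : ℝ) < (n : ℕ) := by exact_mod_cast n.pos
  have hnC : ((n : ℕ) : ℂ) ≠ 0 := by exact_mod_cast n.ne_zero
  have e0 : (((u : ℤ) * (n : ℕ) * q.out 1 0 : ℤ) : ℂ) * τ +
      (((u : ℤ) * (n : ℕ) * q.out 1 1 : ℤ) : ℂ) = ((u : ℤ) : ℂ) * (n : ℕ) * J := by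
    rw [← hJd]
    push_cast
    ring
  have hu : (((u : ℤ) : ℂ)) ^ (-k) = 1 := by
    rcases Int.units_eq_one_or u with rfl | rfl
    · simp
    · simpa using hk.neg.neg_one_zpow
  have hu' : Complex.normSq ((u : ℤ) : ℂ) = 1 := by
    rcases Int.units_eq_one_or u with rfl | rfl <;> simp
  have e1 : τ.im / Complex.normSq (((u : ℤ) : ℂ) * (n : ℕ) * J) =
      ((n : ℕ) : ℝ)⁻¹ ^ 2 * (τ.im / Complex.normSq J) := by
    rw [map_mul, map_mul, hu', Complex.normSq_natCast]
    field_simp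
  rw [e0, e1, mul_zpow, mul_zpow, hu, Complex.ofReal_mul, Complex.mul_cpow_ofReal_nonneg
    (by positivity) (div_nonneg τ.im_pos.le (Complex.normSq_nonneg _)), one_mul]
  have e2 : (((((n : ℕ) : ℝ)⁻¹ ^ 2 : ℝ)) : ℂ) ^ s = ((n : ℕ) : ℂ) ^ (-(2 * s)) := by
    have h := Complex.natCast_cpow_natCast_mul n 2 s
    rw [Nat.cast_ofNat] at h
    rw [Complex.cpow_neg, h, ← Complex.inv_cpow, Complex.ofReal_pow, Complex.ofReal_inv, inv_pow,
      Complex.ofReal_natCast]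
    rw [← Nat.cast_pow, Complex.natCast_arg]
    exact Real.pi_ne_zero.symm
  rw [e2, ← Complex.cpow_intCast, one_div, ← Complex.cpow_neg, neg_add,
    Complex.cpow_add _ _ hnC, Int.cast_neg]
  ring

lemma summable_eisTerm_and_tsum {k : ℤ} (hk : Even k) (τ : ℍ) {s : ℂ} (hs : 2 < 2 * s.re + k) :
    Summable (eisTerm k τ s) ∧
      ∑' v, latticeTerm k τ s v = 2 * riemannZeta (2 * s + k) * eis k τ s := by
  have hre : 1 < (2 * s + k).re := by simp; linarith
  have hS := (summable_norm_latticeTerm τ hs).comp_injective cosetPair_injective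
  have hT : ∑' v, latticeTerm k τ s v = ∑' x, latticeTerm k τ s (cosetPair x) := by
    refine (cosetPair_injective.tsum_eq ?_).symm
    intro v hv
    refine mem_range_cosetPair ?_
    rintro rfl
    exact hv (latticeTerm_zero τ hs)
  -- The cosets form the subfamily with sign 1 and n = 1 of the lattice sum.
  have hE : Summable fun q ↦ ‖eisTerm k τ s q‖ := by
    have := hS.comp_injective (i := fun q : Cosets ↦ (q, ((1 : ℤˣ), (1 : ℕ+)))) (by
      intro a b h
      exact congrArg Prod.fst h)
    refine this.congr fun q ↦ ?_
    simp [latticeTerm_cosetPair hk]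
  have hZ : Summable fun n : ℕ+ ↦ ‖1 / ((n : ℕ) : ℂ) ^ (2 * s + k)‖ :=
    ((Complex.summable_one_div_nat_cpow.mpr hre).norm).comp_injective PNat.coe_injective
  have hU : Summable fun y : ℤˣ × ℕ+ ↦ ‖1 / ((y.2 : ℕ) : ℂ) ^ (2 * s + k)‖ := by
    rw [summable_prod_of_nonneg (fun _ ↦ norm_nonneg _)]
    exact ⟨fun _ ↦ hZ, Summable.of_finite⟩
  refine ⟨hE.of_norm, ?_⟩
  rw [hT]
  simp only [latticeTerm_cosetPair hk]
  have h1 := tsum_mul_tsum_of_summable_norm hE hU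
  rw [← h1, eis, mul_comm]
  congr 1
  rw [hU.of_norm.tsum_prod' (fun _ ↦ hZ.of_norm), tsum_fintype, zeta_eq_tsum_one_div_nat_cpow hre]
  simp only [Finset.sum_const, Finset.card_univ, Fintype.card_units_int, nsmul_eq_mul,
    Nat.cast_ofNat]
  congr 1
  -- Passing from ℕ+ to ℕ needs the term at 0 to vanish, which would fail for exponent 0 because 0^0
  -- = 1.
  have hs0 : 2 * s + k ≠ 0 := by
    intro h
    rw [h, Complex.zero_re] at hre
    linarith
  exact tsum_pnat_eq_tsum_of_eq_zero (f := fun n : ℕ ↦ 1 / (n : ℂ) ^ (2 * s + k)) (by simp [hs0])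

/-! ### Theta functions of the lattice and their functional equation -/

/-- The point `c τ + d` of the lattice `ℤ τ + ℤ`. -/
def latticePoint (τ : ℍ) (v : ℤ × ℤ) : ℂ := (v.1 : ℂ) * τ + v.2

lemma latticePoint_neg (τ : ℍ) (v : ℤ × ℤ) : latticePoint τ (-v) = -latticePoint τ v := by
  simp only [latticePoint, Prod.fst_neg, Prod.snd_neg, Int.cast_neg]
  ring

lemma normSq_latticePoint (τ : ℍ) (v : ℤ × ℤ) :
    Complex.normSq (latticePoint τ v) = (v.1 * τ.re + v.2) ^ 2 + (v.1 * τ.im) ^ 2 := by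
  simp [latticePoint, Complex.normSq_apply]
  ring

/-- Comparison with ‖J‖^(−3): the power ‖J‖^(N+3) is at most (N+3)! e^‖J‖, and completing the square
bounds (b+1)u − au² by (b+1)²/(4a). -/
lemma summable_pow_mul_exp_latticePoint (τ : ℍ) (N : ℕ) (b : ℝ) {a : ℝ} (ha : 0 < a) :
    Summable fun v ↦ ‖latticePoint τ v‖ ^ N *
      Real.exp (b * ‖latticePoint τ v‖ - a * Complex.normSq (latticePoint τ v)) := by
  have hS := (summable_norm_linear_rpow τ (p := 3) (by norm_num)).mul_left
    ((N + 3).factorial * Real.exp ((b + 1) ^ 2 / (4 * a)))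
  refine hS.of_norm_bounded_eventually ?_
  have : ∀ᶠ v : ℤ × ℤ in Filter.cofinite, v ≠ 0 :=
    (Set.finite_singleton (0 : ℤ × ℤ)).eventually_cofinite_notMem
  filter_upwards [this] with v hv
  have hJ := norm_pos_iff.mpr (linear_ne_zero_of_ne_zero τ hv)
  rw [Real.norm_of_nonneg (by positivity), Complex.normSq_eq_norm_sq]
  change _ ≤ _ * ‖latticePoint τ v‖ ^ (-3 : ℝ)
  change 0 < ‖latticePoint τ v‖ at hJ
  generalize ‖latticePoint τ v‖ = u at hJ
  have h1 : u ^ (N + 3) ≤ (N + 3).factorial * Real.exp u := by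
    have := Real.pow_div_factorial_le_exp u hJ.le (N + 3)
    rwa [div_le_iff₀' (by positivity)] at this
  have h2 : Real.exp u * Real.exp (b * u - a * u ^ 2) ≤ Real.exp ((b + 1) ^ 2 / (4 * a)) := by
    rw [← Real.exp_add]
    apply Real.exp_le_exp.mpr
    rw [le_div_iff₀ (by positivity)]
    nlinarith [sq_nonneg (b + 1 - 2 * a * u)]
  rw [show (-3 : ℝ) = -((3 : ℕ) : ℝ) by norm_num, Real.rpow_neg hJ.le, Real.rpow_natCast,
    ← div_eq_mul_inv, le_div_iff₀ (by positivity)]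
  calc u ^ N * Real.exp (b * u - a * u ^ 2) * u ^ 3
      = u ^ (N + 3) * Real.exp (b * u - a * u ^ 2) := by ring
    _ ≤ (N + 3).factorial * Real.exp u * Real.exp (b * u - a * u ^ 2) := by gcongr
    _ = (N + 3).factorial * (Real.exp u * Real.exp (b * u - a * u ^ 2)) := by ring
    _ ≤ _ := by gcongr

/-- The summand of the theta function of the lattice `ℤ τ + ℤ` with an additional linear term in
the exponent. -/
def expTerm (τ : ℍ) (u : ℝ) (w : ℂ) (v : ℤ × ℤ) : ℂ :=
  Complex.exp (-(Real.pi * u ^ 2 / τ.im * Complex.normSq (latticePoint τ v) : ℝ) +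
    w * u * latticePoint τ v)

/-- The summand of the series obtained from the series of `expTerm` by Poisson summation in the
second variable. -/
def dualTerm (τ : ℍ) (u : ℝ) (w : ℂ) (c n : ℤ) : ℂ :=
  Complex.exp (-Real.pi * τ.im * ((u * c) ^ 2 + (n / u) ^ 2) +
    Complex.I * w * τ.im * (u * c - n / u) + 2 * Real.pi * Complex.I * n * c * τ.re)

lemma norm_expTerm_le (τ : ℍ) {u : ℝ} (hu : 0 < u) (w : ℂ) (v : ℤ × ℤ) :
    ‖expTerm τ u w v‖ ≤ Real.exp (‖w‖ * u * ‖latticePoint τ v‖ -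
      Real.pi * u ^ 2 / τ.im * Complex.normSq (latticePoint τ v)) := by
  rw [expTerm, Complex.norm_exp, Complex.add_re, Complex.neg_re, Complex.ofReal_re]
  apply Real.exp_le_exp.mpr
  have := Complex.re_le_norm (w * u * latticePoint τ v)
  rw [norm_mul, norm_mul, Complex.norm_real, Real.norm_of_nonneg hu.le] at this
  linarith

lemma summable_norm_expTerm (τ : ℍ) {u : ℝ} (hu : 0 < u) (w : ℂ) :
    Summable fun v ↦ ‖expTerm τ u w v‖ := by
  have hy := τ.im_pos
  have := summable_pow_mul_exp_latticePoint τ 0 (‖w‖ * u)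
    (a := Real.pi * u ^ 2 / τ.im) (by positivity)
  simp only [pow_zero, one_mul] at this
  exact this.of_nonneg_of_le (fun _ ↦ norm_nonneg _) (norm_expTerm_le τ hu w)

lemma summable_norm_gaussian {a : ℝ} (ha : 0 < a) (b : ℂ) :
    Summable fun n : ℤ ↦ ‖Complex.exp (-a * n ^ 2 + b * n)‖ := by
  have h := (summable_jacobiTheta₂_term_iff (b / (2 * Real.pi * Complex.I))
    (a / Real.pi * Complex.I)).mpr (by
      rw [← Complex.ofReal_div, Complex.im_ofReal_mul, Complex.I_im, mul_one]
      have := Real.pi_pos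
      positivity)
  refine h.norm.congr fun n ↦ ?_
  rw [jacobiTheta₂_term]
  congr 2
  have : (Real.pi : ℂ) ≠ 0 := by exact_mod_cast Real.pi_ne_zero
  field_simp
  linear_combination ((n : ℂ) ^ 2 * a) * Complex.I_sq

lemma summable_dualTerm (τ : ℍ) {u : ℝ} (hu : 0 < u) (w : ℂ) :
    Summable fun p : ℤ × ℤ ↦ dualTerm τ u w p.1 p.2 := by
  have hy := τ.im_pos
  have hpi := Real.pi_pos
  have h := (summable_norm_gaussian (a := Real.pi * τ.im * u ^ 2) (by positivity)
    (Complex.I * w * τ.im * u)).mul_norm (summable_norm_gaussian (a := Real.pi * τ.im / u ^ 2)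
    (by positivity) (-(Complex.I * w * τ.im / u)))
  refine Summable.of_norm (h.congr fun p ↦ ?_)
  rw [← Complex.exp_add, dualTerm, Complex.exp_add _ (2 * Real.pi * Complex.I * _ * _ * _), norm_mul,
    show (2 * Real.pi * Complex.I * (p.2 : ℂ) * p.1 * τ.re) =
      ((2 * Real.pi * p.2 * p.1 * τ.re : ℝ) : ℂ) * Complex.I by push_cast; ring,
    Complex.norm_exp_ofReal_mul_I, mul_one]
  congr 2
  push_cast
  ring

/-- For fixed c the summand is a Gaussian in d, so Poisson summation in d alone applies. `E`
collects what does not depend on d. -/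
lemma tsum_expTerm_snd (τ : ℍ) {u : ℝ} (hu : 0 < u) (w : ℂ) (c : ℤ) :
    u * ∑' d : ℤ, expTerm τ u w (c, d) =
      (Real.sqrt τ.im : ℂ) * Complex.exp (w ^ 2 * τ.im / (4 * Real.pi)) *
        ∑' n : ℤ, dualTerm τ u w c n := by
  have hy := τ.im_pos
  have hyC : (τ.im : ℂ) ≠ 0 := by exact_mod_cast hy.ne'
  have huC : (u : ℂ) ≠ 0 := by exact_mod_cast hu.ne'
  have hpi : (Real.pi : ℂ) ≠ 0 := by exact_mod_cast Real.pi_ne_zero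
  have ha : 0 < ((u ^ 2 / τ.im : ℝ) : ℂ).re := by
    rw [Complex.ofReal_re]; positivity
  have h := Complex.tsum_exp_neg_quadratic ha
    (w * u / (2 * Real.pi) - (u ^ 2 / τ.im : ℝ) * c * τ.re)
  have hsq : ((u ^ 2 / τ.im : ℝ) : ℂ) ^ (1 / 2 : ℂ) = u / (Real.sqrt τ.im : ℂ) := by
    rw [show (1 / 2 : ℂ) = ((1 / 2 : ℝ) : ℂ) by push_cast; ring,
      ← Complex.ofReal_cpow (by positivity), ← Real.sqrt_eq_rpow, Real.sqrt_div (by positivity),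
      Real.sqrt_sq hu.le, Complex.ofReal_div]
  set E : ℂ := Complex.exp (-Real.pi * (u ^ 2 / τ.im) * c ^ 2 * τ.re ^ 2 + w * u * c * τ.re -
    Real.pi * u ^ 2 * c ^ 2 * τ.im + Complex.I * w * u * c * τ.im) with hE
  have h1 : ∀ d : ℤ, expTerm τ u w (c, d) = E * Complex.exp (-Real.pi * (u ^ 2 / τ.im : ℝ) * d ^ 2 +
      2 * Real.pi * (w * u / (2 * Real.pi) - (u ^ 2 / τ.im : ℝ) * c * τ.re) * d) := by
    intro d
    rw [hE, ← Complex.exp_add, expTerm, normSq_latticePoint, latticePoint, ← τ.coe_re, ← τ.coe_im]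
    congr 1
    nth_rewrite 4 [← Complex.re_add_im (τ : ℂ)]
    rw [τ.coe_im, τ.coe_re]
    push_cast
    field_simp
    ring
  have h2 : ∀ n : ℤ, dualTerm τ u w c n * Complex.exp (w ^ 2 * τ.im / (4 * Real.pi)) =
      E * Complex.exp (-Real.pi / (u ^ 2 / τ.im : ℝ) * (n + Complex.I *
        (w * u / (2 * Real.pi) - (u ^ 2 / τ.im : ℝ) * c * τ.re)) ^ 2) := by
    intro n
    rw [hE, ← Complex.exp_add, dualTerm, ← Complex.exp_add]
    congr 1
    push_cast
    field_simp
    ring_nf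
    simp only [Complex.I_sq]
    ring
  simp only [h1]
  have h3 : Complex.exp (w ^ 2 * τ.im / (4 * Real.pi)) * ∑' n : ℤ, dualTerm τ u w c n =
      E * ∑' n : ℤ, Complex.exp (-Real.pi / (u ^ 2 / τ.im : ℝ) * (n + Complex.I *
        (w * u / (2 * Real.pi) - (u ^ 2 / τ.im : ℝ) * c * τ.re)) ^ 2) := by
    rw [← tsum_mul_left, ← tsum_mul_left]
    exact tsum_congr fun n ↦ by rw [mul_comm, h2]
  rw [tsum_mul_left, h, mul_assoc (Real.sqrt τ.im : ℂ), h3, hsq, one_div, inv_div]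
  rw [mul_left_comm E, ← mul_assoc, mul_div_cancel₀ _ huC]

/-- The dual exponent is symmetric in uc and n/u, except that the difference uc − n/u changes sign;
hence the −w. -/
lemma dualTerm_inv (τ : ℍ) {u : ℝ} (hu : 0 < u) (w : ℂ) (c n : ℤ) :
    dualTerm τ u⁻¹ w c n = dualTerm τ u (-w) n c := by
  have huC : (u : ℂ) ≠ 0 := by exact_mod_cast hu.ne'
  rw [dualTerm, dualTerm]
  congr 1
  push_cast
  field_simp
  ring

lemma tsum_expTerm (τ : ℍ) {u : ℝ} (hu : 0 < u) (w : ℂ) :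
    u * ∑' v : ℤ × ℤ, expTerm τ u w v =
      (Real.sqrt τ.im : ℂ) * Complex.exp (w ^ 2 * τ.im / (4 * Real.pi)) *
        ∑' p : ℤ × ℤ, dualTerm τ u w p.1 p.2 := by
  rw [(summable_norm_expTerm τ hu w).of_norm.tsum_prod, (summable_dualTerm τ hu w).tsum_prod,
    ← tsum_mul_left, ← tsum_mul_left]
  exact tsum_congr fun c ↦ tsum_expTerm_snd τ hu w c

/-- Inverting u swaps the two summation variables on the dual side and flips w. The Poisson
prefactor is even in w, and v ↦ −v undoes the flip on the original side. -/
lemma tsum_expTerm_inv (τ : ℍ) {u : ℝ} (hu : 0 < u) (w : ℂ) :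
    (u⁻¹ : ℂ) * ∑' v : ℤ × ℤ, expTerm τ u⁻¹ w v = u * ∑' v : ℤ × ℤ, expTerm τ u w v := by
  have h1 : ∑' v : ℤ × ℤ, expTerm τ u w v = ∑' v : ℤ × ℤ, expTerm τ u (-w) v := by
    rw [← (Equiv.neg (ℤ × ℤ)).tsum_eq]
    refine tsum_congr fun v ↦ ?_
    simp only [Equiv.neg_apply, expTerm, latticePoint_neg, Complex.normSq_neg]
    congr 2
    ring
  have h2 := tsum_expTerm τ (inv_pos.mpr hu) w
  rw [Complex.ofReal_inv] at h2
  rw [h1, tsum_expTerm τ hu, h2, neg_sq]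
  congr 1
  rw [← (Equiv.prodComm ℤ ℤ).tsum_eq]
  exact tsum_congr fun p ↦ dualTerm_inv τ hu w _ _

/-- The theta function of the lattice `ℤ τ + ℤ` with the spherical polynomial `J ^ n`. -/
def theta (τ : ℍ) (n : ℕ) (t : ℝ) : ℂ :=
  ∑' v : ℤ × ℤ, latticePoint τ v ^ n *
    (Real.exp (-(Real.pi / τ.im * Complex.normSq (latticePoint τ v)) * t) : ℝ)

/-- Expanding exp(wuJ) makes the parametrized sum a generating function of all the theta functions;
the Gaussian makes the double series absolutely convergent. -/
lemma hasSum_theta_pow (τ : ℍ) {u : ℝ} (hu : 0 < u) (w : ℂ) :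
    HasSum (fun n : ℕ ↦ w ^ n * (u ^ n / n.factorial * theta τ n (u ^ 2)))
      (∑' v : ℤ × ℤ, expTerm τ u w v) := by
  have hy := τ.im_pos
  set g : ℤ × ℤ → ℝ := fun v ↦
    Real.exp (-(Real.pi / τ.im * Complex.normSq (latticePoint τ v)) * u ^ 2) with hg
  set f : (ℤ × ℤ) × ℕ → ℂ := fun x ↦
    (w * u * latticePoint τ x.1) ^ x.2 / x.2.factorial * (g x.1 : ℂ) with hf
  have hexp : ∀ z : ℂ, HasSum (fun n : ℕ ↦ z ^ n / n.factorial) (Complex.exp z) := fun z ↦ by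
    rw [Complex.exp_eq_exp_ℂ]; exact NormedSpace.expSeries_div_hasSum_exp z
  have hrexp : ∀ z : ℝ, HasSum (fun n : ℕ ↦ z ^ n / n.factorial) (Real.exp z) := fun z ↦ by
    rw [Real.exp_eq_exp_ℝ]; exact NormedSpace.expSeries_div_hasSum_exp z
  have hnorm : ∀ v n, ‖f (v, n)‖ = (‖w‖ * u * ‖latticePoint τ v‖) ^ n / n.factorial * g v := by
    intro v n
    have : ‖(g v : ℂ)‖ = g v := by
      rw [Complex.norm_real, Real.norm_of_nonneg (Real.exp_nonneg _)]
    simp only [hf, norm_mul, norm_div, norm_pow, this, Complex.norm_natCast, Complex.norm_real,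
      Real.norm_of_nonneg hu.le]
  have hfib : ∀ v, HasSum (fun n ↦ ‖f (v, n)‖)
      (Real.exp (‖w‖ * u * ‖latticePoint τ v‖) * g v) := fun v ↦ by
    simp only [hnorm]
    exact (hrexp _).mul_right _
  have hsum : Summable f := by
    refine Summable.of_norm ((summable_prod_of_nonneg (fun _ ↦ norm_nonneg _)).mpr
      ⟨fun v ↦ (hfib v).summable, ?_⟩)
    simp only [fun v ↦ (hfib v).tsum_eq]
    have := summable_pow_mul_exp_latticePoint τ 0 (‖w‖ * u)
      (a := Real.pi * u ^ 2 / τ.im) (by positivity)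
    refine this.congr fun v ↦ ?_
    rw [hg, ← Real.exp_add, pow_zero, one_mul]
    congr 1
    ring
  have h1 : ∑' v : ℤ × ℤ, expTerm τ u w v = ∑' x, f x := by
    rw [hsum.tsum_prod]
    refine tsum_congr fun v ↦ ?_
    rw [((hexp (w * u * latticePoint τ v)).mul_right (g v : ℂ)).tsum_eq, expTerm, hg,
      Complex.ofReal_exp, ← Complex.exp_add]
    congr 1
    push_cast
    ring
  rw [h1, ← (Equiv.prodComm _ _).tsum_eq]
  have hsum' := (Equiv.prodComm ℕ (ℤ × ℤ)).summable_iff.mpr hsum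
  have h3 := hsum'.hasSum.prod_fiberwise fun n ↦ (hsum'.prod_factor n).hasSum
  refine Eq.mp (congrArg (fun F ↦ HasSum F _) (funext fun n ↦ ?_)) h3
  symm
  rw [theta, ← tsum_mul_left, ← tsum_mul_left]
  refine tsum_congr fun v ↦ ?_
  simp only [hf, hg, Function.comp_apply, Equiv.prodComm_apply, Prod.swap_prod_mk]
  ring

lemma eq_of_hasSum_pow_mul {a b : ℕ → ℂ} {f : ℂ → ℂ}
    (ha : ∀ w, HasSum (fun n ↦ w ^ n * a n) (f w)) (hb : ∀ w, HasSum (fun n ↦ w ^ n * b n) (f w)) :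
    a = b := by
  have h : ∀ a : ℕ → ℂ, (∀ w, HasSum (fun n ↦ w ^ n * a n) (f w)) →
      HasFPowerSeriesAt f (FormalMultilinearSeries.ofScalars ℂ a) 0 := by
    intro a ha
    rw [hasFPowerSeriesAt_iff]
    refine Filter.Eventually.of_forall fun w ↦ ?_
    simpa [FormalMultilinearSeries.coeff_ofScalars] using ha w
  have := (h a ha).eq_formalMultilinearSeries (h b hb)
  funext n
  have := congrArg (fun p ↦ FormalMultilinearSeries.coeff p n) this
  simpa [FormalMultilinearSeries.coeff_ofScalars] using this

/-- With u = √t, the coefficient of w^n in `tsum_expTerm_inv` reads u^(−n−1) θ(1/t) = u^(n+1) θ(t),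
after cancelling n!. -/
lemma theta_inv (τ : ℍ) (n : ℕ) {t : ℝ} (ht : 0 < t) :
    theta τ n (1 / t) = (t : ℂ) ^ (n + 1) * theta τ n t := by
  set u := Real.sqrt t with hu
  have hu0 : 0 < u := Real.sqrt_pos.mpr ht
  have huC : (u : ℂ) ≠ 0 := by exact_mod_cast hu0.ne'
  have hut : t = u ^ 2 := (Real.sq_sqrt ht.le).symm
  have h := eq_of_hasSum_pow_mul
    (a := fun n ↦ (u⁻¹ : ℂ) * (((u⁻¹ : ℝ) : ℂ) ^ n / n.factorial * theta τ n (u⁻¹ ^ 2)))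
    (b := fun n ↦ (u : ℂ) * ((u : ℂ) ^ n / n.factorial * theta τ n (u ^ 2)))
    (f := fun w ↦ u * ∑' v : ℤ × ℤ, expTerm τ u w v)
    (fun w ↦ by
      rw [← tsum_expTerm_inv τ hu0 w]
      simpa only [mul_left_comm] using
        (hasSum_theta_pow τ (inv_pos.mpr hu0) w).mul_left (u⁻¹ : ℂ))
    (fun w ↦ by
      simpa only [mul_left_comm] using (hasSum_theta_pow τ hu0 w).mul_left (u : ℂ))
  have h' := congrFun h n
  rw [show 1 / t = u⁻¹ ^ 2 by rw [hut]; field_simp, hut]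
  have hfac : ((n.factorial : ℕ) : ℂ) ≠ 0 := by exact_mod_cast n.factorial_ne_zero
  push_cast at h' ⊢
  generalize theta τ n (u⁻¹ ^ 2) = A at h' ⊢
  generalize theta τ n (u ^ 2) = B at h' ⊢
  field_simp at h'
  rw [one_div, inv_pow, inv_mul_eq_iff_eq_mul₀ (pow_ne_zero n huC)] at h'
  rw [h']
  ring

lemma continuousOn_theta (τ : ℍ) (n : ℕ) : ContinuousOn (theta τ n) (Set.Ioi 0) := by
  have hpi := Real.pi_pos
  have hy := τ.im_pos
  intro t₀ (ht₀ : 0 < t₀)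
  have h : ContinuousOn (theta τ n) (Set.Ioi (t₀ / 2)) := by
    refine continuousOn_tsum (fun v ↦ by fun_prop) (summable_pow_mul_exp_latticePoint τ n 0
      (a := Real.pi / τ.im * (t₀ / 2)) (by positivity)) fun v t (ht : t₀ / 2 < t) ↦ ?_
    rw [norm_mul, norm_pow, Complex.norm_real, Real.norm_of_nonneg (Real.exp_nonneg _)]
    have := Complex.normSq_nonneg (latticePoint τ v)
    gcongr
    have : Real.pi / τ.im * Complex.normSq (latticePoint τ v) * (t₀ / 2) ≤
      Real.pi / τ.im * Complex.normSq (latticePoint τ v) * t := by gcongr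
    linarith
  exact (h.continuousAt (Ioi_mem_nhds (by linarith))).continuousWithinAt

lemma exists_pos_le_normSq (τ : ℍ) :
    ∃ δ > 0, ∀ v ≠ 0, δ ≤ Complex.normSq (latticePoint τ v) := by
  refine ⟨min 1 (τ.im ^ 2), lt_min one_pos (pow_pos τ.im_pos 2), fun v hv ↦ ?_⟩
  rw [normSq_latticePoint]
  have hone : ∀ a : ℤ, a ≠ 0 → (1 : ℝ) ≤ (a : ℝ) ^ 2 := fun a ha ↦ by
    exact_mod_cast Int.one_le_abs (pow_ne_zero 2 ha) |>.trans_eq (abs_of_nonneg (sq_nonneg a))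
  by_cases hc : v.1 = 0
  · have hd : v.2 ≠ 0 := fun hd ↦ hv (Prod.ext hc hd)
    refine (min_le_left _ _).trans ?_
    simpa [hc] using hone _ hd
  · refine (min_le_right _ _).trans ?_
    have := hone _ hc
    nlinarith [sq_nonneg (v.1 * τ.re + v.2), sq_nonneg τ.im, mul_pow (v.1 : ℝ) τ.im 2]

/-- The coefficients of the theta function `theta τ n` without its constant term. -/
def thetaCoeff (τ : ℍ) (n : ℕ) (v : ℤ × ℤ) : ℂ := if v = 0 then 0 else latticePoint τ v ^ n

lemma summable_theta (τ : ℍ) (n : ℕ) {t : ℝ} (ht : 0 < t) :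
    Summable fun v ↦ latticePoint τ v ^ n *
      (Real.exp (-(Real.pi / τ.im * Complex.normSq (latticePoint τ v)) * t) : ℝ) := by
  have hpi := Real.pi_pos
  have hy := τ.im_pos
  refine Summable.of_norm ((summable_pow_mul_exp_latticePoint τ n 0
      (a := Real.pi / τ.im * t) (by positivity)).congr fun v ↦ ?_)
  rw [norm_mul, norm_pow, Complex.norm_real, Real.norm_of_nonneg (Real.exp_nonneg _)]
  congr 2
  ring

/-- The origin contributes 0^n, that is, 1 for n = 0 and nothing otherwise. This is what sets weight
zero apart later. -/
lemma hasSum_theta_sub (τ : ℍ) (n : ℕ) {t : ℝ} (ht : 0 < t) :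
    HasSum (fun v ↦ thetaCoeff τ n v *
      (Real.exp (-(Real.pi / τ.im * Complex.normSq (latticePoint τ v)) * t) : ℝ))
      (theta τ n t - 0 ^ n) := by
  have h := (summable_theta τ n ht).hasSum.sub (hasSum_ite_eq (0 : ℤ × ℤ) ((0 : ℂ) ^ n))
  refine Eq.mp (congrArg (fun F ↦ HasSum F _) (funext fun v ↦ ?_)) h
  rcases eq_or_ne v 0 with rfl | hv
  · simp [latticePoint, thetaCoeff]
  · simp [thetaCoeff, hv]

open Filter Asymptotics in
-- For t ≥ 1 and p ≥ κ one has pt ≥ p + κ(t − 1), so e^(−κt) comes out of the series, leaving the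
-- convergent one at t = 1.
lemma theta_sub_isBigO (τ : ℍ) (n : ℕ) (r : ℝ) :
    (fun t ↦ theta τ n t - 0 ^ n) =O[atTop] fun t : ℝ ↦ t ^ r := by
  have hpi := Real.pi_pos
  have hy := τ.im_pos
  obtain ⟨δ, hδ, hle⟩ := exists_pos_le_normSq τ
  set p : ℤ × ℤ → ℝ := fun v ↦ Real.pi / τ.im * Complex.normSq (latticePoint τ v)
  set κ := Real.pi / τ.im * δ
  have hκ_pos : 0 < κ := by positivity
  have hS : Summable fun v ↦ ‖thetaCoeff τ n v‖ * Real.exp (-p v) := by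
    refine (hasSum_theta_sub τ n one_pos).summable.norm.congr fun v ↦ ?_
    rw [norm_mul, Complex.norm_real, Real.norm_of_nonneg (Real.exp_nonneg _), mul_one]
  have hO : (fun t ↦ theta τ n t - 0 ^ n) =O[atTop] fun t : ℝ ↦ Real.exp (-κ * t) := by
    refine IsBigO.of_bound ((∑' v, ‖thetaCoeff τ n v‖ * Real.exp (-p v)) * Real.exp κ) ?_
    filter_upwards [eventually_ge_atTop 1] with t ht
    rw [← (hasSum_theta_sub τ n (zero_lt_one.trans_le ht)).tsum_eq,
      Real.norm_of_nonneg (Real.exp_nonneg _), ← tsum_mul_right, ← tsum_mul_right]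
    refine tsum_of_norm_bounded ((hS.mul_right _).mul_right _).hasSum fun v ↦ ?_
    rw [norm_mul, Complex.norm_real, Real.norm_of_nonneg (Real.exp_nonneg _), mul_assoc,
      mul_assoc, ← Real.exp_add, ← Real.exp_add]
    rcases eq_or_ne v 0 with rfl | hv
    · simp [thetaCoeff]
    · gcongr
      have h1 : κ ≤ p v := mul_le_mul_of_nonneg_left (hle v hv) (by positivity)
      change -p v * t ≤ _
      nlinarith
  exact hO.trans (isLittleO_exp_neg_mul_rpow_atTop hκ_pos r).isBigO

/-! ### Mellin transform and continuation of the lattice sums -/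

/-- The functional equation of `theta τ n`, packaged for the Mellin transform. -/
def thetaPair (τ : ℍ) (n : ℕ) : WeakFEPair ℂ where
  f := theta τ n
  g := theta τ n
  k := n + 1
  ε := 1
  f₀ := 0 ^ n
  g₀ := 0 ^ n
  hf_int := (continuousOn_theta τ n).locallyIntegrableOn measurableSet_Ioi
  hg_int := (continuousOn_theta τ n).locallyIntegrableOn measurableSet_Ioi
  hk := by positivity
  hε := one_ne_zero
  h_feq t ht := by
    rw [theta_inv τ n ht, one_mul, smul_eq_mul, ← Nat.cast_succ, Real.rpow_natCast,
      Complex.ofReal_pow]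
  hf_top := theta_sub_isBigO τ n
  hg_top := theta_sub_isBigO τ n

lemma mellin_theta (τ : ℍ) (n : ℕ) {s : ℂ} (hs : 2 < 2 * s.re - n) :
    mellin (fun t ↦ theta τ n t - 0 ^ n) s =
      (Real.pi : ℂ) ^ (-s) * Complex.Gamma s * ∑' v, latticeTerm (-n) τ s v := by
  have hpi := Real.pi_pos
  have hy := τ.im_pos
  have hs0 : 0 < s.re := by
    have : (0 : ℝ) ≤ n := n.cast_nonneg
    linarith
  have hs' : 2 < 2 * s.re + ((-(n : ℤ) : ℤ) : ℝ) := by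
    push_cast
    linarith
  have hpos : ∀ v ≠ 0, 0 < Complex.normSq (latticePoint τ v) := fun v hv ↦
    Complex.normSq_pos.mpr (linear_ne_zero_of_ne_zero τ hv)
  have hterm : ∀ v, Complex.Gamma s * thetaCoeff τ n v /
      ((Real.pi / τ.im * Complex.normSq (latticePoint τ v) : ℝ) : ℂ) ^ s =
      (Real.pi : ℂ) ^ (-s) * Complex.Gamma s * latticeTerm (-n) τ s v := by
    intro v
    rcases eq_or_ne v 0 with rfl | hv
    · rw [latticeTerm_zero τ hs']
      simp [thetaCoeff]
    · have h0 := hpos v hv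
      rw [show Real.pi / τ.im * Complex.normSq (latticePoint τ v) =
        Real.pi * (τ.im / Complex.normSq (latticePoint τ v))⁻¹ by field_simp,
        Complex.ofReal_mul, Complex.mul_cpow_ofReal_nonneg hpi.le (by positivity),
        Complex.ofReal_inv, Complex.inv_cpow _ _ (by
          rw [Complex.arg_ofReal_of_nonneg (by positivity)]; exact hpi.ne),
        thetaCoeff, if_neg hv, latticeTerm, neg_neg, zpow_natCast, Complex.cpow_neg]
      change _ = _ * _ * (latticePoint τ v ^ n * _)
      rw [← latticePoint]
      field_simp
  have h := hasSum_mellin (a := thetaCoeff τ n)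
    (p := fun v ↦ Real.pi / τ.im * Complex.normSq (latticePoint τ v))
    (F := fun t ↦ theta τ n t - 0 ^ n) (s := s) (fun v ↦ ?_) hs0
    (fun t ht ↦ hasSum_theta_sub τ n ht) ?_
  · rw [← h.tsum_eq, ← tsum_mul_left]
    exact tsum_congr hterm
  · rcases eq_or_ne v 0 with rfl | hv
    · simp [thetaCoeff]
    · right
      have := hpos v hv
      positivity
  · have hG : ‖Complex.Gamma s‖ ≠ 0 := norm_ne_zero_iff.mpr (Complex.Gamma_ne_zero_of_re_pos hs0)
    refine ((summable_norm_latticeTerm τ hs').mul_left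
      ‖(Real.pi : ℂ) ^ (-s)‖).congr fun v ↦ ?_
    have := congrArg norm (hterm v)
    rcases eq_or_ne v 0 with rfl | hv
    · rw [latticeTerm_zero τ hs']
      simp [thetaCoeff]
    rw [norm_div, norm_mul, norm_mul, norm_mul, Complex.norm_cpow_eq_rpow_re_of_pos (by
      have := hpos v hv
      positivity)] at this
    apply mul_left_cancel₀ hG
    rw [← mul_div_assoc, this]
    ring

lemma tsum_latticeTerm_eq_of_mellin (τ : ℍ) (n : ℕ) {s : ℂ} (hs : 2 < 2 * s.re - n) :
    ∑' v, latticeTerm (-n) τ s v = (Real.pi : ℂ) ^ s * (1 / Complex.Gamma s) *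
      mellin (fun t ↦ theta τ n t - 0 ^ n) s := by
  have hs0 : 0 < s.re := by
    have : (0 : ℝ) ≤ n := n.cast_nonneg
    linarith
  have hG := Complex.Gamma_ne_zero_of_re_pos hs0
  have hp : (Real.pi : ℂ) ^ s ≠ 0 := by simp [Complex.cpow_eq_zero_iff, Real.pi_ne_zero]
  rw [mellin_theta τ n hs, Complex.cpow_neg]
  field_simp

lemma differentiable_one_div_Gamma_comp {f : ℂ → ℂ} (hf : Differentiable ℂ f) :
    Differentiable ℂ fun z ↦ 1 / Complex.Gamma (f z) := by
  simp only [one_div]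
  exact Complex.differentiable_one_div_Gamma.comp hf

/-- The only poles of the completed function occur for n = 0, at s = 0 and s = 1. Division by Γ(s)
removes the first; the second is the pole at z = 2, with z = 2s − n. -/
lemma exists_entire_of_nonpos_weight (τ : ℍ) (n : ℕ) :
    ∃ H : ℂ → ℂ, Differentiable ℂ H ∧ ∀ s : ℂ, 2 < 2 * s.re - n →
      ∑' v, latticeTerm (-n) τ s v = H (2 * s - n) / (2 * s - n - 2) := by
  have hpi : (Real.pi : ℂ) ≠ 0 := by exact_mod_cast Real.pi_ne_zero
  have hne : ∀ s : ℂ, 2 < 2 * s.re - n → 2 * s - n - 2 ≠ 0 := by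
    intro s hs h
    have := congrArg Complex.re h
    simp at this
    linarith
  have hpow : Differentiable ℂ fun z : ℂ ↦ (Real.pi : ℂ) ^ ((z + n) / 2) := fun z ↦
    (by fun_prop : DifferentiableAt ℂ (fun z : ℂ ↦ (z + n) / 2) z).const_cpow (Or.inl hpi)
  have hGam : Differentiable ℂ fun z : ℂ ↦ 1 / Complex.Gamma ((z + n) / 2) :=
    differentiable_one_div_Gamma_comp (by fun_prop)
  have hs2 : ∀ s : ℂ, (2 * s - n + n) / 2 = s := fun s ↦ by ring
  rcases Nat.eq_zero_or_pos n with rfl | hn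
  · have hL : Differentiable ℂ fun z : ℂ ↦ (thetaPair τ 0).Λ₀ ((z + (0 : ℕ)) / 2) :=
      (thetaPair τ 0).differentiable_Λ₀.comp (by fun_prop)
    have hGam' : Differentiable ℂ fun z : ℂ ↦ 1 / Complex.Gamma ((z + (0 : ℕ)) / 2 + 1) :=
      differentiable_one_div_Gamma_comp (by fun_prop)
    -- Comes from Λ = Λ₀ − 1/s − 1/(1−s) with s = z/2: 1/(sΓ(s)) is rewritten as 1/Γ(s+1), and
    -- −1/(1−s) = 2/(z−2) gives the last summand.
    refine ⟨fun z ↦ (z - 2) * ((Real.pi : ℂ) ^ ((z + (0 : ℕ)) / 2) *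
      (1 / Complex.Gamma ((z + (0 : ℕ)) / 2) * (thetaPair τ 0).Λ₀ ((z + (0 : ℕ)) / 2) -
        1 / Complex.Gamma ((z + (0 : ℕ)) / 2 + 1))) +
      2 * ((Real.pi : ℂ) ^ ((z + (0 : ℕ)) / 2) * (1 / Complex.Gamma ((z + (0 : ℕ)) / 2))), ?_, ?_⟩
    · exact ((by fun_prop : Differentiable ℂ fun z : ℂ ↦ z - 2).mul
        (hpow.mul ((hGam.mul hL).sub hGam'))).add ((hpow.mul hGam).const_mul 2)
    · intro s hs
      have h1 : (thetaPair τ 0).k < s.re := by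
        simp [thetaPair] at hs ⊢
        linarith
      have h2 := ((thetaPair τ 0).hasMellin h1).2
      have h3 : s ≠ 0 := by
        rintro rfl
        simp at hs
        linarith
      have h4 := hne s hs
      have hG : Complex.Gamma s ≠ 0 := Complex.Gamma_ne_zero_of_re_pos (by
        simp at hs
        linarith)
      rw [tsum_latticeTerm_eq_of_mellin τ 0 hs]
      change mellin (fun t ↦ theta τ 0 t - 0 ^ 0) s = _ at h2
      have h5 : (1 : ℂ) - s ≠ 0 := by
        intro h
        apply h4
        push_cast
        linear_combination (-2) * h
      simp only [hs2]
      rw [h2, WeakFEPair.Λ, Complex.Gamma_add_one s h3]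
      generalize (thetaPair τ 0).Λ₀ s = L
      simp only [thetaPair, pow_zero, smul_eq_mul, Nat.cast_zero, sub_zero, zero_add,
        Complex.ofReal_one, mul_one] at h4 ⊢
      rw [show 2 * s - 2 = -2 * (1 - s) by ring]
      field_simp
      ring
  · have h0 : (thetaPair τ n).f₀ = 0 := zero_pow hn.ne'
    have hstrong : IsStrongFEPair (thetaPair τ n) := ⟨h0, h0⟩
    have hL : Differentiable ℂ fun z : ℂ ↦ (thetaPair τ n).Λ ((z + n) / 2) :=
      Differentiable.comp (fun _ ↦ (thetaPair τ n).differentiableAt_Λ (Or.inr h0) (Or.inr h0))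
        (by fun_prop : Differentiable ℂ fun z : ℂ ↦ (z + n) / 2)
    -- Without a constant term Λ is entire; the factor z − 2 only fits the common shape of the
    -- denominator.
    refine ⟨fun z ↦ (z - 2) * ((Real.pi : ℂ) ^ ((z + n) / 2) *
      (1 / Complex.Gamma ((z + n) / 2)) * (thetaPair τ n).Λ ((z + n) / 2)), ?_, ?_⟩
    · exact (by fun_prop : Differentiable ℂ fun z : ℂ ↦ z - 2).mul ((hpow.mul hGam).mul hL)
    · intro s hs
      have h4 := hne s hs
      rw [tsum_latticeTerm_eq_of_mellin τ n hs, hstrong.Λ_eq]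
      simp only [hs2, zero_pow hn.ne', sub_zero]
      rw [mul_div_cancel_left₀ _ h4]
      rfl

/-- The image of `τ` under the reflection in the imaginary axis. -/
def reflect (τ : ℍ) : ℍ := ⟨-starRingEnd ℂ (τ : ℂ), by simpa using τ.im_pos⟩

/-- J^(−n) = conj(J)^n |J|^(−2n), where conj J is the lattice point of −conj τ at (−c, d) and
|J|^(−2n) shifts s by n. -/
lemma latticeTerm_reflect (τ : ℍ) (n : ℕ) {s : ℂ} (hs : 2 < 2 * s.re + n) (v : ℤ × ℤ) :
    latticeTerm n τ s v =
      ((τ.im : ℂ) ^ n)⁻¹ * latticeTerm (-n) (reflect τ) (s + n) (-v.1, v.2) := by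
  have hy := τ.im_pos
  have hyC : (τ.im : ℂ) ≠ 0 := by exact_mod_cast hy.ne'
  rcases eq_or_ne v 0 with rfl | hv
  · have h1 := latticeTerm_zero (k := n) τ (s := s) (by simpa using hs)
    have h2 := latticeTerm_zero (k := -n) (reflect τ) (s := s + n) (by
      simp
      linarith)
    rw [h1, Prod.fst_zero, Prod.snd_zero, neg_zero, Prod.mk_zero_zero, h2, mul_zero]
  have hJ := linear_ne_zero_of_ne_zero τ hv
  have e0 : (((-v.1 : ℤ)) : ℂ) * (reflect τ : ℂ) + v.2 =
      starRingEnd ℂ ((v.1 : ℂ) * τ + v.2) := by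
    simp [reflect]
  have e1 : (reflect τ).im = τ.im := by
    rw [← coe_im]; simp [reflect]
  rw [latticeTerm, latticeTerm]
  dsimp only
  rw [e0, e1, Complex.normSq_conj]
  generalize (v.1 : ℂ) * τ + v.2 = J at hJ
  have hcJ : starRingEnd ℂ J ≠ 0 := (map_ne_zero (starRingEnd ℂ)).mpr hJ
  have hY : ((τ.im / Complex.normSq J : ℝ) : ℂ) ≠ 0 := by
    exact_mod_cast (div_pos hy (Complex.normSq_pos.mpr hJ)).ne'
  rw [Complex.cpow_add _ _ hY, Complex.cpow_natCast, neg_neg, zpow_natCast, zpow_neg,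
    zpow_natCast]
  have e2 : ((τ.im / Complex.normSq J : ℝ) : ℂ) ^ n =
      (τ.im : ℂ) ^ n / (J ^ n * starRingEnd ℂ J ^ n) := by
    rw [Complex.ofReal_div, ← Complex.mul_conj, div_pow, mul_pow]
  rw [e2]
  field_simp

lemma exists_entire_latticeTerm (τ : ℍ) (k : ℤ) :
    ∃ H : ℂ → ℂ, Differentiable ℂ H ∧ ∀ s : ℂ, 2 < 2 * s.re + k →
      ∑' v, latticeTerm k τ s v = H (2 * s + k) / (2 * s + k - 2) := by
  obtain ⟨n, rfl | rfl⟩ := k.eq_nat_or_neg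
  · obtain ⟨H, hH, hs⟩ := exists_entire_of_nonpos_weight (reflect τ) n
    refine ⟨fun z ↦ ((τ.im : ℂ) ^ n)⁻¹ * H z, hH.const_mul _, fun s hre ↦ ?_⟩
    have hre' : 2 < 2 * s.re + n := by simpa using hre
    simp only [latticeTerm_reflect τ n hre']
    have h := ((Equiv.neg ℤ).prodCongr (Equiv.refl ℤ)).tsum_eq
      (latticeTerm (-n) (reflect τ) (s + n))
    simp only [Equiv.prodCongr_apply, Prod.map, Equiv.neg_apply, Equiv.refl_apply] at h
    rw [tsum_mul_left, h, hs _ (by simp; linarith),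
      show 2 * (s + n) - (n : ℂ) = 2 * s + (n : ℤ) by push_cast; ring, mul_div_assoc]
  · obtain ⟨H, hH, hs⟩ := exists_entire_of_nonpos_weight τ n
    refine ⟨H, hH, fun s hre ↦ ?_⟩
    rw [hs s (by simpa [sub_eq_add_neg] using hre)]
    simp [sub_eq_add_neg]

lemma exists_entire_eis (τ : ℍ) {k : ℤ} (hk : Even k) :
    ∃ H : ℂ → ℂ, Differentiable ℂ H ∧ ∀ s : ℂ, 2 < 2 * s.re + k →
      eis k τ s = H (2 * s + k) / ((2 * s + k - 2) * riemannZeta (2 * s + k)) := by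
  obtain ⟨H, hH, h⟩ := exists_entire_latticeTerm τ k
  refine ⟨fun z ↦ H z / 2, hH.div_const 2, fun s hs ↦ ?_⟩
  have hz : riemannZeta (2 * s + k) ≠ 0 := riemannZeta_ne_zero_of_one_le_re (by simp; linarith)
  have h1 := (summable_eisTerm_and_tsum hk τ hs).2
  rw [h s hs] at h1
  rw [← div_div, div_right_comm (H _), h1]
  field_simp

/-! ### Polynomial-valued sums and pole orders -/

/-- The degree bound matters because `polySum` discards coefficients beyond m. -/
lemma polySum_sum_mul_C {ι : Type} {m : ℕ} (S : Finset ℕ) {A : ℕ → ℂ[X]}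
    (hA : ∀ r ∈ S, (A r).natDegree ≤ m) {e : ℕ → ι → ℂ} (he : ∀ r ∈ S, Summable (e r)) :
    PolySummable (fun q ↦ ∑ r ∈ S, A r * C (e r q)) ∧
      polySum m (fun q ↦ ∑ r ∈ S, A r * C (e r q)) = ∑ r ∈ S, A r * C (∑' q, e r q) := by
  have hs : ∀ i, ∀ r ∈ S, Summable fun q ↦ (A r).coeff i * e r q := fun i r hr ↦
    (he r hr).mul_left _
  refine ⟨fun i ↦ ?_, ?_⟩
  · simp only [finsetSum_coeff, coeff_mul_C]
    exact summable_sum (hs i)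
  · ext i
    simp only [polySum, finsetSum_coeff, coeff_mul_C, coeff_monomial]
    rw [Finset.sum_ite_eq' (Finset.range (m + 1)) i]
    split_ifs with hi
    · rw [Summable.tsum_finsetSum (hs i)]
      exact Finset.sum_congr rfl fun r _ ↦ tsum_mul_left
    · refine (Finset.sum_eq_zero fun r hr ↦ ?_).symm
      rw [coeff_eq_zero_of_natDegree_lt, zero_mul]
      rw [Finset.mem_range] at hi
      have := hA r hr
      omega

lemma natDegree_frakE_le (r l : ℕ) (τ : ℍ) : (frakE r l τ).natDegree ≤ r + l := by
  rw [frakE, mul_assoc]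
  refine (natDegree_C_mul_le _ _).trans (natDegree_mul_le.trans ?_)
  simp

lemma analyticAt_riemannZeta {z : ℂ} (hz : z ≠ 1) : AnalyticAt ℂ riemannZeta z := by
  refine DifferentiableOn.analyticAt (s := {1}ᶜ) (fun w hw ↦ ?_)
    (isOpen_compl_singleton.mem_nhds hz)
  exact (differentiableAt_riemannZeta hw).differentiableWithinAt

open Filter Topology in
-- 1/ζ(z) = (z−1)/((z−1)ζ(z)), whose denominator extends analytically with value 1. Equality is
-- claimed only off z = 1, so the value assigned to ζ at 1 plays no role.
lemma exists_analyticAt_inv_riemannZeta_one :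
    ∃ f : ℂ → ℂ, AnalyticAt ℂ f 1 ∧ riemannZeta⁻¹ =ᶠ[𝓝[≠] 1] f := by
  set g := Function.update (fun s : ℂ ↦ (s - 1) * riemannZeta s) 1 1 with hg
  have hga : AnalyticAt ℂ g 1 := by
    refine Complex.analyticAt_of_differentiable_on_punctured_nhds_of_continuousAt ?_
      (continuousAt_update_same.mpr riemannZeta_residue_one)
    filter_upwards [self_mem_nhdsWithin] with z hz
    have h : DifferentiableAt ℂ (fun s : ℂ ↦ (s - 1) * riemannZeta s) z :=
      (differentiableAt_id.sub_const 1).mul (differentiableAt_riemannZeta hz)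
    refine h.congr_of_eventuallyEq ?_
    filter_upwards [isOpen_compl_singleton.mem_nhds hz] with w hw
    rw [hg, Function.update_of_ne hw]
  refine ⟨fun z ↦ (z - 1) * (g z)⁻¹, ((analyticAt_id.sub analyticAt_const)).mul
    (hga.inv (by simp [hg])), ?_⟩
  filter_upwards [self_mem_nhdsWithin] with z hz
  have hz' : z - 1 ≠ 0 := sub_ne_zero.mpr hz
  rw [hg, Function.update_of_ne hz, Pi.inv_apply]
  rw [mul_inv, ← mul_assoc, mul_inv_cancel₀ hz', one_mul]

lemma meromorphicAt_inv_riemannZeta (z : ℂ) : MeromorphicAt riemannZeta⁻¹ z := by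
  rcases eq_or_ne z 1 with rfl | hz
  · obtain ⟨f, hf, hfe⟩ := exists_analyticAt_inv_riemannZeta_one
    exact hf.meromorphicAt.congr hfe.symm
  · exact (analyticAt_riemannZeta hz).meromorphicAt.inv

lemma le_meromorphicOrderAt_inv_riemannZeta (z : ℂ) :
    ((-(analyticOrderNatAt riemannZeta z : ℤ) : ℤ) : WithTop ℤ) ≤
      meromorphicOrderAt riemannZeta⁻¹ z := by
  rcases eq_or_ne z 1 with rfl | hz
  · obtain ⟨f, hf, hfe⟩ := exists_analyticAt_inv_riemannZeta_one
    rw [meromorphicOrderAt_congr hfe]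
    refine le_trans ?_ hf.meromorphicOrderAt_nonneg
    exact_mod_cast neg_nonpos.mpr (Int.natCast_nonneg _)
  · rw [meromorphicOrderAt_inv, (analyticAt_riemannZeta hz).meromorphicOrderAt_eq,
      analyticOrderNatAt]
    cases h : analyticOrderAt riemannZeta z with
    | top => simp
    | coe n => simp

/-- The factors z − 2 and ζ have no common zero, as ζ(2) ≠ 0. At each point only one can cause a
pole, hence a maximum and not a sum. -/
lemma le_meromorphicOrderAt_div_riemannZeta {H : ℂ → ℂ} (hH : Differentiable ℂ H) (z : ℂ) :
    MeromorphicAt (fun w ↦ H w / ((w - 2) * riemannZeta w)) z ∧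
    ((-(max 1 (analyticOrderNatAt riemannZeta z) : ℕ) : ℤ) : WithTop ℤ) ≤
      meromorphicOrderAt (fun w ↦ H w / ((w - 2) * riemannZeta w)) z := by
  have hHa : AnalyticAt ℂ H z := hH.analyticAt z
  have hζ := meromorphicAt_inv_riemannZeta z
  have hp : AnalyticAt ℂ (fun w : ℂ ↦ w - 2) z := by fun_prop
  have heq : (fun w ↦ H w / ((w - 2) * riemannZeta w)) =
      H * ((fun w : ℂ ↦ w - 2)⁻¹ * riemannZeta⁻¹) := by
    funext w
    simp [div_eq_mul_inv, mul_comm]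
  rw [heq]
  have hm := hp.meromorphicAt.inv.mul hζ
  refine ⟨hHa.meromorphicAt.mul hm, ?_⟩
  rw [meromorphicOrderAt_mul hHa.meromorphicAt hm,
    meromorphicOrderAt_mul hp.meromorphicAt.inv hζ]
  have h1 := hHa.meromorphicOrderAt_nonneg
  suffices h : ((-(max 1 (analyticOrderNatAt riemannZeta z) : ℕ) : ℤ) : WithTop ℤ) ≤
      meromorphicOrderAt (fun w : ℂ ↦ w - 2)⁻¹ z + meromorphicOrderAt riemannZeta⁻¹ z from
    h.trans (le_add_of_nonneg_left h1)
  rcases eq_or_ne z 2 with rfl | hz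
  · have h2 : meromorphicOrderAt (fun w : ℂ ↦ w - 2)⁻¹ 2 = ((-1 : ℤ) : WithTop ℤ) := by
      rw [meromorphicOrderAt_inv, meromorphicOrderAt_id_sub_const]
      rfl
    have h3 : AnalyticAt ℂ riemannZeta⁻¹ 2 :=
      (analyticAt_riemannZeta (by norm_num)).inv (riemannZeta_ne_zero_of_one_le_re (by norm_num))
    rw [h2]
    refine le_trans ?_ (le_add_of_nonneg_right h3.meromorphicOrderAt_nonneg)
    rw [WithTop.coe_le_coe]
    exact neg_le_neg (by exact_mod_cast le_max_left 1 (analyticOrderNatAt riemannZeta 2))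
  · have h2 : AnalyticAt ℂ (fun w : ℂ ↦ w - 2)⁻¹ z := hp.inv (sub_ne_zero.mpr hz)
    refine le_trans ?_ (le_add_of_nonneg_left h2.meromorphicOrderAt_nonneg)
    refine le_trans ?_ (le_meromorphicOrderAt_inv_riemannZeta z)
    rw [WithTop.coe_le_coe]
    exact neg_le_neg (by exact_mod_cast le_max_right 1 (analyticOrderNatAt riemannZeta z))

lemma le_meromorphicOrderAt_div_riemannZeta_comp {H : ℂ → ℂ} (hH : Differentiable ℂ H) (κ s : ℂ) :
    MeromorphicAt (fun w ↦ H (2 * w + κ) / ((2 * w + κ - 2) * riemannZeta (2 * w + κ))) s ∧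
    ((-(max 1 (analyticOrderNatAt riemannZeta (2 * s + κ)) : ℕ) : ℤ) : WithTop ℤ) ≤
      meromorphicOrderAt
        (fun w ↦ H (2 * w + κ) / ((2 * w + κ - 2) * riemannZeta (2 * w + κ))) s := by
  obtain ⟨h1, h2⟩ := le_meromorphicOrderAt_div_riemannZeta hH (2 * s + κ)
  have hg : AnalyticAt ℂ (fun w : ℂ ↦ 2 * w + κ) s := by fun_prop
  have hd : deriv (fun w : ℂ ↦ 2 * w + κ) s ≠ 0 := by
    have : HasDerivAt (fun w : ℂ ↦ 2 * w + κ) (2 * 1) s :=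
      ((hasDerivAt_id s).const_mul 2).add_const κ
    rw [this.deriv]
    norm_num
  refine ⟨MeromorphicAt.comp_analyticAt (g := fun w : ℂ ↦ 2 * w + κ) h1 hg, h2.trans_eq ?_⟩
  exact (meromorphicOrderAt_comp_of_deriv_ne_zero (f := fun w ↦ H w / ((w - 2) * riemannZeta w))
    hg hd).symm

/-- The polynomial coefficient of `E_{k-m+2r}` in the expansion of `E_{k,m}`. -/
def expansionCoeff (m j : ℕ) (τ : ℍ) (r : ℕ) : ℂ[X] :=
  C ((Complex.I / 2) ^ (m - j)) * (C (((m - j).choose (r - j) : ℂ) * (r.factorial : ℂ)) *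
    frakE r (m - r) τ)

lemma natDegree_expansionCoeff_le {m j : ℕ} (τ : ℍ) {r : ℕ} (hr : r ∈ Finset.Icc j m) :
    (expansionCoeff m j τ r).natDegree ≤ m := by
  refine (natDegree_C_mul_le _ _).trans ((natDegree_C_mul_le _ _).trans
    ((natDegree_frakE_le _ _ _).trans ?_))
  have := (Finset.mem_Icc.mp hr).2
  omega

lemma sum_expansionCoeff (m j : ℕ) (τ : ℍ) (e : ℕ → ℂ) :
    ∑ r ∈ Finset.Icc j m, expansionCoeff m j τ r * C (e r) =
      C ((Complex.I / 2) ^ (m - j)) * ∑ r ∈ Finset.Icc j m,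
        C (((m - j).choose (r - j) : ℂ) * (r.factorial : ℂ)) *
          (frakE r (m - r) τ * C (e r)) := by
  rw [Finset.mul_sum]
  exact Finset.sum_congr rfl fun r _ ↦ by rw [expansionCoeff]; ring

lemma even_weight {k : ℤ} {m : ℕ} (hkm : k ≡ (m : ℤ) [ZMOD 2]) (r : ℕ) :
    Even (k - m + 2 * r) := by
  rw [Int.even_iff]
  have := hkm.eq
  omega

/-- The shifts of s and of the weight cancel: the quantity controlling convergence is 2 Re s + k − m
+ 2j for every r. -/
lemma summable_eisTerm_shift {k : ℤ} {m : ℕ} (hkm : k ≡ (m : ℤ) [ZMOD 2]) (j r : ℕ) (τ : ℍ)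
    {s : ℂ} (hs : 2 + (m : ℝ) < 2 * s.re + k) :
    2 < 2 * (s - r + j).re + ((k - m + 2 * r : ℤ) : ℝ) ∧
      Summable (eisTerm (k - m + 2 * r) τ (s - r + j)) := by
  have h : 2 < 2 * (s - r + j).re + ((k - m + 2 * r : ℤ) : ℝ) := by
    have : (0 : ℝ) ≤ j := j.cast_nonneg
    simp
    linarith
  exact ⟨h, (summable_eisTerm_and_tsum (even_weight hkm r) τ h).1⟩

lemma vEis_eq {k : ℤ} {m : ℕ} (hkm : k ≡ (m : ℤ) [ZMOD 2]) {j : ℕ} (hj : j ≤ m) (τ : ℍ)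
    {s : ℂ} (hs : 2 + (m : ℝ) < 2 * s.re + k) :
    PolySummable (vEisTerm k m τ j s) ∧ vEis k m τ j s = ∑ r ∈ Finset.Icc j m,
      expansionCoeff m j τ r * C (eis (k - m + 2 * r) τ (s - r + j)) := by
  have h := polySum_sum_mul_C (Finset.Icc j m) (A := expansionCoeff m j τ)
    (e := fun r ↦ eisTerm (k - m + 2 * r) τ (s - r + j))
    (fun r hr ↦ natDegree_expansionCoeff_le τ hr)
    (fun r _ ↦ (summable_eisTerm_shift hkm j r τ hs).2)
  have he : vEisTerm k m τ j s = fun q ↦ ∑ r ∈ Finset.Icc j m, expansionCoeff m j τ r *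
      C (eisTerm (k - m + 2 * r) τ (s - r + j) q) := by
    funext q
    rw [vEisTerm_eq k hj,
      sum_expansionCoeff m j τ fun r ↦ eisTerm (k - m + 2 * r) τ (s - r + j) q]
  rw [vEis, he]
  exact h

lemma aholEis_eq {k : ℤ} {m r : ℕ} (hr : r ≤ m) (τ : ℍ) {s : ℂ}
    (hs : Summable (eisTerm (k - m + 2 * r) τ s)) :
    PolySummable (aholEisTerm k m τ r s) ∧
      aholEis k m τ r s = frakE r (m - r) τ * C (eis (k - m + 2 * r) τ s) := by
  have h := polySum_sum_mul_C (m := m) {r} (A := fun r ↦ frakE r (m - r) τ)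
    (e := fun r ↦ eisTerm (k - m + 2 * r) τ s)
    (fun r' hr' ↦ by
      rw [Finset.mem_singleton.mp hr']
      exact (natDegree_frakE_le _ _ _).trans (by omega))
    (fun r' hr' ↦ by rwa [Finset.mem_singleton.mp hr'])
  simp only [Finset.sum_singleton] at h
  rw [aholEis, show aholEisTerm k m τ r s = _ from funext fun q ↦ aholEisTerm_eq k hr τ s q]
  exact h

lemma exists_meromorphic_continuation_vEis {k : ℤ} {m : ℕ} (hkm : k ≡ (m : ℤ) [ZMOD 2]) {j : ℕ}
    (hj : j ≤ m) (τ : ℍ) :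
    ∃ F : ℂ → ℂ[X],
      (∀ s, (F s).natDegree ≤ m) ∧
      (∀ s : ℂ, 2 + (m : ℝ) < 2 * s.re + (k : ℝ) → F s = vEis k m τ j s) ∧
      ∀ (i : ℕ) (s : ℂ), MeromorphicAt (fun z ↦ (F z).coeff i) s ∧
        ((-(max 1 (analyticOrderNatAt riemannZeta (2 * s + k - m + 2 * j)) : ℕ) : ℤ) :
            WithTop ℤ) ≤ meromorphicOrderAt (fun z ↦ (F z).coeff i) s := by
  choose H hH hHe using fun r ↦ exists_entire_eis τ (even_weight hkm r)
  set κ : ℂ := k - m + 2 * j with hκ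
  refine ⟨fun s ↦ ∑ r ∈ Finset.Icc j m, expansionCoeff m j τ r *
    C (H r (2 * s + κ) / ((2 * s + κ - 2) * riemannZeta (2 * s + κ))), fun s ↦ ?_, fun s hs ↦ ?_,
    fun i s ↦ ?_⟩
  · refine natDegree_sum_le_of_forall_le _ _ fun r hr ↦ ?_
    exact (natDegree_mul_C_le _ _).trans (natDegree_expansionCoeff_le τ hr)
  · rw [(vEis_eq hkm hj τ hs).2]
    refine Finset.sum_congr rfl fun r _ ↦ ?_
    rw [hHe r _ (summable_eisTerm_shift hkm j r τ hs).1,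
      show 2 * (s - r + j) + ((k - m + 2 * r : ℤ) : ℂ) = 2 * s + κ by
        rw [hκ]; push_cast; ring]
  -- With one denominator for all r, each coefficient is a single quotient with entire numerator, so
  -- the bound for one term applies directly.
  · have hG : Differentiable ℂ fun z ↦
        ∑ r ∈ Finset.Icc j m, (expansionCoeff m j τ r).coeff i * H r z :=
      Differentiable.fun_sum fun r _ ↦ (hH r).const_mul _
    have h := le_meromorphicOrderAt_div_riemannZeta_comp hG κ s
    rw [show 2 * s + k - m + 2 * j = 2 * s + κ by rw [hκ]; ring]
    simp only [finsetSum_coeff, coeff_mul_C]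
    simpa only [Finset.sum_div, mul_div_assoc] using h

end

end VVEisenstein

theorem mainTheorem8 (k : ℤ) (m : ℕ) (hkm : k ≡ (m : ℤ) [ZMOD 2]) (j : ℕ) (hj : j ≤ m) (τ : ℍ) :
    (∀ s : ℂ, 2 + (m : ℝ) < 2 * s.re + (k : ℝ) →
      VVEisenstein.PolySummable (VVEisenstein.vEisTerm k m τ j s) ∧
      (∀ r ∈ Finset.Icc j m,
        Summable (VVEisenstein.eisTerm (k - m + 2 * r) τ (s - r + j)) ∧
        VVEisenstein.PolySummable (VVEisenstein.aholEisTerm k m τ r (s - r + j))) ∧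
      VVEisenstein.vEis k m τ j s =
        C ((Complex.I / 2) ^ (m - j)) * ∑ r ∈ Finset.Icc j m,
          C (((m - j).choose (r - j) : ℂ) * (r.factorial : ℂ)) *
            (VVEisenstein.frakE r (m - r) τ *
              C (VVEisenstein.eis (k - m + 2 * r) τ (s - r + j))) ∧
      VVEisenstein.vEis k m τ j s =
        C ((Complex.I / 2) ^ (m - j)) * ∑ r ∈ Finset.Icc j m,
          C (((m - j).choose (r - j) : ℂ) * (r.factorial : ℂ)) *
            VVEisenstein.aholEis k m τ r (s - r + j)) ∧
    ∃ F : ℂ → ℂ[X],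
      (∀ s, (F s).natDegree ≤ m) ∧
      (∀ s : ℂ, 2 + (m : ℝ) < 2 * s.re + (k : ℝ) → F s = VVEisenstein.vEis k m τ j s) ∧
      (∀ i : ℕ, MeromorphicOn (fun s ↦ (F s).coeff i) Set.univ) ∧
      (∀ (i : ℕ) (s : ℂ),
        ((-(max 1 (analyticOrderNatAt riemannZeta (2 * s + k - m + 2 * j)) : ℕ) : ℤ) :
            WithTop ℤ) ≤ meromorphicOrderAt (fun z ↦ (F z).coeff i) s) := by
  refine ⟨fun s hs ↦ ?_, ?_⟩
  · obtain ⟨h1, h2⟩ := VVEisenstein.vEis_eq hkm hj τ hs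
    have h3 : ∀ r ∈ Finset.Icc j m, _ := fun r hr ↦ VVEisenstein.aholEis_eq
      (Finset.mem_Icc.mp hr).2 τ (VVEisenstein.summable_eisTerm_shift hkm j r τ hs).2
    rw [VVEisenstein.sum_expansionCoeff] at h2
    refine ⟨h1, fun r hr ↦ ⟨(VVEisenstein.summable_eisTerm_shift hkm j r τ hs).2, (h3 r hr).1⟩,
      h2, h2.trans ?_⟩
    congr 1
    exact Finset.sum_congr rfl fun r hr ↦ by rw [(h3 r hr).2]
  · obtain ⟨F, h1, h2, h3⟩ := VVEisenstein.exists_meromorphic_continuation_vEis hkm hj τ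
    exact ⟨F, h1, h2, fun i s _ ↦ (h3 i s).1, fun i s ↦ (h3 i s).2⟩
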